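/- Let $k\ge 2$ be an integer and $B_1=[-1,1]$. Write $\mathrm{Ai}_k(\xi)=\mathcal F^{-1}[e^{ix^{k+1}}](\xi)=(2\pi)^{-1/2}\int_{-\infty}^{\infty}e^{ix\xi+ix^{k+1}}\,dx$ (an improper integral, which converges for every $\xi\in\mathbb R$) and $c_k=(2\pi)^{1/2}\,((k+1)!)^{1/(k+1)}$. There is a constant $C$ depending only on $k$ such that the following holds. Let $\psi\in C_0^\infty(\mathbb R;\mathbb C)$ be supported in $B_1$, and let $\phi$ be a real-valued function that is $C^{k+1}$ on $B_1$ with $\phi^{(k+1)}$ absolutely continuous on $B_1$ (for instance, $\phi\in C^{k+2}(B_1)$), such that (H1) $\phi(0)=\phi'(0)=\dots=\phi^{(k)}(0)=0$; (H2) $\frac1{10}\le\phi^{(k+1)}(x)\le 10$ for $|x|\le 1$. For $\lambda>0$ let $I(\lambda)=\int_{\mathbb R}e^{i\lambda\phi(x)}\psi(x)\,dx$ and define $R(\lambda)$ by $$I(\lambda)=\lambda^{-\frac1{k+1}}\,\frac{c_k\,\psi(0)\,\mathrm{Ai}_k(0)}{[\phi^{(k+1)}(0)]^{\frac1{k+1}}}+R(\lambda).$$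 Then for all $\lambda>0$ and all $p\in(1,2]$, with $\frac1p+\frac1{p'}=1$, $$|R(\lambda)|\le C\,\lambda^{-\frac1{k+1}}\,\lambda^{-\frac1{(k+1)p'}}\Big(\|\phi^{(k+2)}\|_{L^p(B_1)}\|\psi\|_{L^\infty(B_1)}+\|\psi'\|_{L^\infty(B_1)}\Big).$$ (The bound is void if $\phi^{(k+2)}\notin L^p(B_1)$ and $\psi\neq 0$.) -/

import Mathlib

open MeasureTheory Filter Topology
open scoped ENNReal NNReal ContDiff

noncomputable section

namespace OscInt

/-- The closed unit ball of `ℝ`. -/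
def B1 : Set ℝ := Set.Icc (-1) 1

/-- The `j`-th derivative of `φ` on the closed unit ball (one-sided at the end points). -/
def dB1 (j : ℕ) (φ : ℝ → ℝ) : ℝ → ℝ := iteratedDerivWithin j φ B1

/-- The oscillatory integral `I(l) = ∫ exp(i l φ(x)) ψ(x) dx` over the real line. -/
def oscI (φ : ℝ → ℝ) (ψ : ℝ → ℂ) (l : ℝ) : ℂ :=
  ∫ x : ℝ, Complex.exp (Complex.I * (l * φ x : ℝ)) * ψ x

/-- The truncation to `[a, b]` of the inverse Fourier integral
`(2π)^(-1/2) ∫ exp(i x ξ) f(x) dx`. -/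
def invFourierTrunc (f : ℝ → ℂ) (ξ : ℝ) (ab : ℝ × ℝ) : ℂ :=
  ((Real.sqrt (2 * Real.pi))⁻¹ : ℝ) *
    ∫ x in ab.1..ab.2, Complex.exp (Complex.I * (x * ξ : ℝ)) * f x

/-- The inverse Fourier transform with normalization `(2π)^(-1/2)`, as an improper integral:
the limit of the truncated integrals as the end points tend independently to `-∞` and `+∞`. -/
def invFourier (f : ℝ → ℂ) (ξ : ℝ) : ℂ :=
  limUnder (atBot ×ˢ atTop) (invFourierTrunc f ξ)

/-- The function `x ↦ exp(i x^(k+1))`. -/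
def expPow (k : ℕ) (x : ℝ) : ℂ := Complex.exp (Complex.I * (x ^ (k + 1) : ℝ))

/-- The generalized Airy function `Ai_k`, the inverse Fourier transform of `exp(i x^(k+1))`. -/
def Ai (k : ℕ) : ℝ → ℂ := invFourier (expPow k)

/-- The constant `c_k = (2π)^(1/2) ((k+1)!)^(1/(k+1))`. -/
def cConst (k : ℕ) : ℝ :=
  Real.sqrt (2 * Real.pi) * ((k + 1).factorial : ℝ) ^ (1 / ((k : ℝ) + 1))

/-- The leading term
`l^(-1/(k+1)) c_k ψ(0) Ai_k(0) / φ^(k+1)(0)^(1/(k+1))`. -/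
def leading (k : ℕ) (φ : ℝ → ℝ) (ψ : ℝ → ℂ) (l : ℝ) : ℂ :=
  (l ^ (-(1 / ((k : ℝ) + 1))) : ℝ) *
    ((cConst k : ℂ) * ψ 0 * Ai k 0 / ((dB1 (k + 1) φ 0) ^ (1 / ((k : ℝ) + 1)) : ℝ))

/-- The remainder `R(l)`. -/
def remainder (k : ℕ) (φ : ℝ → ℝ) (ψ : ℝ → ℂ) (l : ℝ) : ℂ :=
  oscI φ ψ l - leading k φ ψ l

/-- The hypotheses on the phase: `φ` is `C^(k+1)` on the closed unit ball and `φ^(k+1)` is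
absolutely continuous there (so that `φ^(k+2)` exists almost everywhere and is the weak derivative
of `φ^(k+1)`; this holds in particular for `φ` of class `C^(k+2)`), `φ` and its derivatives
up to order `k` vanish at `0`, and `1/10 ≤ φ^(k+1) ≤ 10` on the closed unit ball. -/
structure IsPhase (k : ℕ) (φ : ℝ → ℝ) : Prop where
  contDiffOn : ContDiffOn ℝ ((k + 1 : ℕ) : WithTop ℕ∞) φ B1
  absCont : AbsolutelyContinuousOnInterval (dB1 (k + 1) φ) (-1) 1
  vanish : ∀ j ≤ k, dB1 j φ 0 = 0
  bounds : ∀ x ∈ B1, 1 / 10 ≤ dB1 (k + 1) φ x ∧ dB1 (k + 1) φ x ≤ 10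

end OscInt

end

namespace OscInt
open Set

/-! Put N = k + 1, s = 1 - 1/p = 1/p', and let D be the L^p norm of φ^(k+2). Absolute continuity and
Hölder's inequality give |φ^(N)(x) - φ^(N)(0)| ≤ D |x|^s (`IsPhase.holder`). Splitting at 0 and
reflecting the negative half leaves two problems on [0, 1].

There let a = φ^(N)(0)/N! and y = (φ/a)^(1/N), so that the phase is exactly a y^N. Taylor bounds
give y' - 1 = O(D x^s) and y'' = O(D x^(s-1)) (`HalfPhase.exists_jac_bound`). Write ψ = ψ(0) y' + h.
In the variable y the first part is the model integral of exp(iλ a y^N); completed to the half-line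
it gives the leading term, and the discarded tail is O(1/λ). The amplitude h is O(x^s). Cut its
integral at δ = λ^(-1/N): the size of h on [0, δ] and one integration by parts on [δ, 1] both give
O(δ^(1+s)), which is the claimed order (`HalfPhase.norm_integral_le`).

Since ψ vanishes at the end points, |ψ| ≤ ‖ψ'‖_∞ on the interval. This absorbs the errors without a
factor D: the tail, and the whole remainder when λ ≤ 1, where no oscillation is used
(`exists_half_bound`). -/

/-! ### Nonstationary phase estimates. -/

/-- One integration by parts in an oscillatory integral with nonstationary phase. -/
theorem norm_integral_exp_mul_le {S T μ : ℝ} (hST : S ≤ T) (hμ : μ ≠ 0)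
    {θ θ' θ'' B : ℝ → ℝ} {h h' : ℝ → ℂ}
    (hθ : ContinuousOn θ (Icc S T)) (hθ' : ContinuousOn θ' (Icc S T))
    (hθ'' : ContinuousOn θ'' (Icc S T))
    (hh : ContinuousOn h (Icc S T)) (hh' : ContinuousOn h' (Icc S T))
    (dθ : ∀ x ∈ Ioo S T, HasDerivAt θ (θ' x) x)
    (dθ' : ∀ x ∈ Ioo S T, HasDerivAt θ' (θ'' x) x)
    (dh : ∀ x ∈ Ioo S T, HasDerivAt h (h' x) x)
    (hpos : ∀ x ∈ Icc S T, 0 < θ' x)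
    (hB : ∀ x ∈ Ioc S T, ‖h' x / θ' x - h x * θ'' x / (θ' x : ℂ) ^ 2‖ ≤ B x)
    (hBi : IntervalIntegrable B volume S T) :
    ‖∫ x in S..T, Complex.exp (Complex.I * (μ * θ x : ℝ)) * h x‖ ≤
      (‖h S‖ / θ' S + ‖h T‖ / θ' T + ∫ x in S..T, B x) / |μ| := by
  set e : ℝ → ℂ := fun x => Complex.exp (Complex.I * (μ * θ x : ℝ)) with he
  have hne : ∀ x, ‖e x‖ = 1 := fun x => by
    rw [he]; simp only; rw [mul_comm]; exact Complex.norm_exp_ofReal_mul_I _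
  have hec : ContinuousOn e (Icc S T) := by
    apply Complex.continuous_exp.comp_continuousOn
    exact continuousOn_const.mul
      (Complex.continuous_ofReal.comp_continuousOn (continuousOn_const.mul hθ))
  have hc' : ContinuousOn (fun x => (θ' x : ℂ)) (Icc S T) :=
    Complex.continuous_ofReal.comp_continuousOn hθ'
  have hc'' : ContinuousOn (fun x => (θ'' x : ℂ)) (Icc S T) :=
    Complex.continuous_ofReal.comp_continuousOn hθ''
  have hne' : ∀ x ∈ Icc S T, (θ' x : ℂ) ≠ 0 := fun x hx => by
    exact_mod_cast (hpos x hx).ne'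
  -- `G' = iμ e h + e r`, so the integral of `e h` is controlled by the boundary values of `G` and
  -- the integral of `r`.
  set G : ℝ → ℂ := fun x => e x * (h x / θ' x) with hG
  set r : ℝ → ℂ := fun x => h' x / θ' x - h x * θ'' x / (θ' x : ℂ) ^ 2 with hr
  have hGc : ContinuousOn G (Icc S T) := hec.mul (hh.div hc' hne')
  have hrc : ContinuousOn r (Icc S T) :=
    (hh'.div hc' hne').sub ((hh.mul hc'').div (hc'.pow 2) fun x hx => pow_ne_zero _ (hne' x hx))
  have hGd : ∀ x ∈ Ioo S T, HasDerivAt G (Complex.I * μ * (e x * h x) + e x * r x) x := by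
    intro x hx
    have hx' := Ioo_subset_Icc_self hx
    have h1 : HasDerivAt e (e x * (Complex.I * (μ * θ' x : ℝ))) x :=
      ((((dθ x hx).const_mul μ).ofReal_comp).const_mul Complex.I).cexp
    have h2 := h1.mul ((dh x hx).div ((dθ' x hx).ofReal_comp) (hne' x hx'))
    refine h2.congr_deriv ?_
    have := hne' x hx'
    simp only [hr, Pi.div_apply]
    push_cast
    field_simp
  have i1 : IntervalIntegrable (fun x => e x * h x) volume S T :=
    (hec.mul hh).intervalIntegrable_of_Icc hST
  have i2 : IntervalIntegrable (fun x => e x * r x) volume S T :=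
    (hec.mul hrc).intervalIntegrable_of_Icc hST
  have key := intervalIntegral.integral_eq_sub_of_hasDerivAt_of_le hST hGc hGd
    ((i1.const_mul _).add i2)
  rw [intervalIntegral.integral_add (i1.const_mul _) i2,
    intervalIntegral.integral_const_mul] at key
  have hr2 : ‖∫ x in S..T, e x * r x‖ ≤ ∫ x in S..T, B x := by
    apply intervalIntegral.norm_integral_le_of_norm_le hST _ hBi
    filter_upwards with x hx
    rw [norm_mul, hne, one_mul]
    exact hB x hx
  have hGn : ∀ x ∈ Icc S T, ‖G x‖ = ‖h x‖ / θ' x := fun x hx => by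
    rw [hG]; simp only
    rw [norm_mul, hne, one_mul, norm_div, Complex.norm_real, Real.norm_of_nonneg (hpos x hx).le]
  have e1 : Complex.I * μ * ∫ x in S..T, e x * h x = G T - G S - ∫ x in S..T, e x * r x := by
    rw [← key]; ring
  have e2 := congrArg norm e1
  rw [norm_mul, norm_mul, Complex.norm_I, one_mul, Complex.norm_real, Real.norm_eq_abs] at e2
  rw [le_div_iff₀ (abs_pos.2 hμ), mul_comm, e2]
  have := norm_sub_le (G T - G S) (∫ x in S..T, e x * r x)
  have := norm_sub_le (G T) (G S)
  rw [hGn T (right_mem_Icc.2 hST), hGn S (left_mem_Icc.2 hST)] at this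
  linarith

/-- Van der Corput's bound for a phase with positive increasing derivative. -/
theorem norm_integral_exp_le {S T μ : ℝ} (hST : S ≤ T) (hμ : μ ≠ 0)
    {θ θ' θ'' : ℝ → ℝ} (hθ'' : ContinuousOn θ'' (Icc S T))
    (dθ : ∀ x ∈ Icc S T, HasDerivAt θ (θ' x) x)
    (dθ' : ∀ x ∈ Icc S T, HasDerivAt θ' (θ'' x) x)
    (hpos : ∀ x ∈ Icc S T, 0 < θ' x) (hnn : ∀ x ∈ Icc S T, 0 ≤ θ'' x) :
    ‖∫ x in S..T, Complex.exp (Complex.I * (μ * θ x : ℝ))‖ ≤ 2 / (|μ| * θ' S) := by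
  have hθ : ContinuousOn θ (Icc S T) := fun x hx => (dθ x hx).continuousAt.continuousWithinAt
  have hθ' : ContinuousOn θ' (Icc S T) := fun x hx => (dθ' x hx).continuousAt.continuousWithinAt
  have hBc : ContinuousOn (fun x => θ'' x / θ' x ^ 2) (Icc S T) :=
    hθ''.div (hθ'.pow 2) fun x hx => pow_ne_zero _ (hpos x hx).ne'
  have hBi : IntervalIntegrable (fun x => θ'' x / θ' x ^ 2) volume S T :=
    hBc.intervalIntegrable_of_Icc hST
  have key := norm_integral_exp_mul_le (h := fun _ => 1) (h' := fun _ => 0)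
    (B := fun x => θ'' x / θ' x ^ 2) hST hμ hθ hθ' hθ'' continuousOn_const continuousOn_const
    (fun x hx => dθ x (Ioo_subset_Icc_self hx)) (fun x hx => dθ' x (Ioo_subset_Icc_self hx))
    (fun x _ => hasDerivAt_const x 1) hpos
    (fun x hx => by
      have hx' := Ioc_subset_Icc_self hx
      rw [zero_div, zero_sub, norm_neg, one_mul, norm_div, norm_pow, Complex.norm_real,
        Complex.norm_real, Real.norm_of_nonneg (hpos x hx').le, Real.norm_of_nonneg (hnn x hx')])
    hBi
  -- As `θ'' ≥ 0`, the error integrand is itself the derivative of `-1 / θ'`; the boundary terms at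
  -- `T` cancel and `2 / θ' S` remains.
  have hint : ∫ x in S..T, θ'' x / θ' x ^ 2 = (θ' S)⁻¹ - (θ' T)⁻¹ := by
    rw [intervalIntegral.integral_eq_sub_of_hasDerivAt_of_le (f := fun x => -(θ' x)⁻¹) hST
      (hθ'.inv₀ fun x hx => (hpos x hx).ne').neg _ hBi]
    · ring
    · intro x hx
      have hx' := Ioo_subset_Icc_self hx
      refine ((dθ' x hx').inv (hpos x hx').ne').neg.congr_deriv ?_
      ring
  simp only [mul_one, norm_one, hint] at key
  refine key.trans (le_of_eq ?_)
  have := (hpos S (left_mem_Icc.2 hST)).ne'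
  have := (abs_pos.2 hμ).ne'
  field_simp
  ring

/-! ### Taylor bounds and powers near one. -/

/-- Upper Taylor bound for a chain of derivatives vanishing at the origin. -/
theorem le_mul_pow_div_factorial {N : ℕ} {f : ℕ → ℝ → ℝ} {X B : ℝ}
    (hd : ∀ j < N, ∀ x ∈ Icc 0 X, HasDerivWithinAt (f j) (f (j + 1) x) (Icc 0 X) x)
    (h0 : ∀ j < N, f j 0 = 0) (hB : ∀ x ∈ Icc 0 X, f N x ≤ B) (m : ℕ) :
    ∀ j, j + m = N → ∀ x ∈ Icc 0 X, f j x ≤ B * (x ^ m / m.factorial) := by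
  induction m with
  | zero => intro j hj x hx; obtain rfl : j = N := by omega
            simpa using hB x hx
  | succ m ih =>
    intro j hj x₀ hx₀
    have hj' : j < N := by omega
    refine image_le_of_deriv_right_le_deriv_boundary (f' := f (j + 1))
      (B := fun x => B * (x ^ (m + 1) / (m + 1).factorial))
      (B' := fun x => B * (x ^ m / m.factorial)) ?_ ?_ ?_ ?_ ?_ ?_ hx₀
    · exact fun x hx => (hd j hj' x hx).continuousWithinAt
    · intro x hx
      exact (hd j hj' x (Ico_subset_Icc_self hx)).mono_of_mem_nhdsWithin
        (mem_of_superset (Icc_mem_nhdsGE hx.2) (Icc_subset_Icc_left hx.1))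
    · simp [h0 j hj']
    · fun_prop
    · intro x _
      refine (((hasDerivAt_pow (m + 1) x).div_const _).const_mul B).hasDerivWithinAt.congr_deriv ?_
      rw [Nat.factorial_succ]
      push_cast
      field_simp
    · intro x hx
      exact ih (j + 1) (by omega) x (Ico_subset_Icc_self hx)

theorem mul_pow_div_factorial_le {N : ℕ} {f : ℕ → ℝ → ℝ} {X B : ℝ}
    (hd : ∀ j < N, ∀ x ∈ Icc 0 X, HasDerivWithinAt (f j) (f (j + 1) x) (Icc 0 X) x)
    (h0 : ∀ j < N, f j 0 = 0) (hB : ∀ x ∈ Icc 0 X, B ≤ f N x) (m : ℕ) :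
    ∀ j, j + m = N → ∀ x ∈ Icc 0 X, B * (x ^ m / m.factorial) ≤ f j x := by
  intro j hj x hx
  have := le_mul_pow_div_factorial (f := fun j x => -f j x) (B := -B)
    (fun j hj x hx => (hd j hj x hx).neg) (fun j hj => by simp [h0 j hj])
    (fun x hx => neg_le_neg (hB x hx)) m j hj x hx
  linarith

/-- Mean value inequality on a compact interval away from 0. The interval is the range of a quotient
of two numbers in [1/10, 10]. -/
theorem exists_abs_rpow_sub_one_le (α : ℝ) :
    ∃ L : ℝ, 0 ≤ L ∧ ∀ t ∈ Icc (1 / 100 : ℝ) 100, |t ^ α - 1| ≤ L * |t - 1| := by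
  have hc : ContinuousOn (fun t : ℝ => α * t ^ (α - 1)) (Icc (1 / 100 : ℝ) 100) := by
    apply continuousOn_const.mul
    intro t ht
    exact (Real.continuousAt_rpow_const t _
      (Or.inl (by linarith [ht.1] : (0:ℝ) < t).ne')).continuousWithinAt
  obtain ⟨L, hL⟩ := isCompact_Icc.exists_bound_of_continuousOn hc
  have h1 : (1 : ℝ) ∈ Icc (1 / 100 : ℝ) 100 := by constructor <;> norm_num
  refine ⟨L, (norm_nonneg _).trans (hL 1 h1), fun t ht => ?_⟩
  have := (convex_Icc (1 / 100 : ℝ) 100).norm_image_sub_le_of_norm_hasDerivWithin_le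
    (f := fun t : ℝ => t ^ α) (f' := fun t => α * t ^ (α - 1)) (C := L)
    (fun t ht => (Real.hasDerivAt_rpow_const
      (Or.inl (by linarith [ht.1] : (0:ℝ) < t).ne')).hasDerivWithinAt) hL h1 ht
  simpa [Real.norm_eq_abs] using this

/-! ### The model integral on the half-line. -/

/-- The convergence of half-line oscillatory integrals with phase `x ^ N + ξ x`. -/
theorem exists_tendsto_integral_exp_pow {N : ℕ} (hN : 3 ≤ N) {μ : ℝ} (hμ : μ ≠ 0) (ξ : ℝ) :
    ∃ L : ℂ, Tendsto (fun T : ℝ => ∫ x in (0 : ℝ)..T,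
      Complex.exp (Complex.I * (μ * (x ^ N + ξ * x) : ℝ))) atTop (𝓝 L) := by
  have hcont : Continuous fun x : ℝ => Complex.exp (Complex.I * (μ * (x ^ N + ξ * x) : ℝ)) := by
    fun_prop
  obtain ⟨n, rfl⟩ : ∃ n, N = n + 3 := ⟨N - 3, by omega⟩
  have hmu := abs_pos.2 hμ
  -- Past `1 + |ξ|` the power term is at least `2 x`, and one `x` absorbs `ξ`.
  have hlow : ∀ x : ℝ, 1 + |ξ| ≤ x → x ≤ ((n + 3 : ℕ) : ℝ) * x ^ (n + 2) + ξ := by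
    intro x hx
    have h1 : 1 ≤ x := by linarith [abs_nonneg ξ]
    have h2 : x ≤ x ^ (n + 2) := le_self_pow₀ h1 (by omega)
    have h3 : 2 * x ^ (n + 2) ≤ ((n + 3 : ℕ) : ℝ) * x ^ (n + 2) := by
      gcongr
      push_cast
      linarith [(Nat.cast_nonneg n : (0 : ℝ) ≤ n)]
    linarith [neg_abs_le ξ]
  apply cauchySeq_tendsto_of_complete
  rw [Metric.cauchySeq_iff']
  intro ε hε
  -- With phase derivative at least `S`, van der Corput bounds the increment by `2 / (|μ| S) ≤ ε /
  -- 2`.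
  refine ⟨max (1 + |ξ|) (4 / (|μ| * ε)), fun T hT => ?_⟩
  set S := max (1 + |ξ|) (4 / (|μ| * ε)) with hS
  have hS1 : 1 + |ξ| ≤ S := le_max_left _ _
  have hS2 : 4 / (|μ| * ε) ≤ S := le_max_right _ _
  have hS0 : 0 < S := by linarith [abs_nonneg ξ]
  rw [dist_eq_norm, intervalIntegral.integral_interval_sub_left
    (hcont.intervalIntegrable _ _) (hcont.intervalIntegrable _ _)]
  have key := norm_integral_exp_le (S := S) (T := T) (μ := μ) hT hμ
    (θ := fun x => x ^ (n + 3) + ξ * x) (θ' := fun x => ((n + 3 : ℕ) : ℝ) * x ^ (n + 2) + ξ)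
    (θ'' := fun x => ((n + 3 : ℕ) : ℝ) * (((n + 2 : ℕ) : ℝ) * x ^ (n + 1)))
    (by fun_prop)
    (fun x _ => ((hasDerivAt_pow (n + 3) x).add ((hasDerivAt_id x).const_mul ξ)).congr_deriv
      (by simp))
    (fun x _ => (((hasDerivAt_pow (n + 2) x).const_mul _).add_const ξ).congr_deriv (by simp))
    (fun x hx => by
      have := hlow x (hS1.trans hx.1)
      have := hx.1
      linarith)
    (fun x hx => by
      have : 0 ≤ x := hS0.le.trans hx.1
      positivity)
  refine key.trans_lt ?_
  have h1 : |μ| * S ≤ |μ| * (((n + 3 : ℕ) : ℝ) * S ^ (n + 2) + ξ) := by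
    gcongr
    exact hlow S hS1
  have h2 : 4 ≤ S * (|μ| * ε) := by rwa [div_le_iff₀ (by positivity)] at hS2
  rw [div_lt_iff₀ (lt_of_lt_of_le (by positivity) h1)]
  nlinarith

/-- The tail bound for the half-line integral of `exp (i σ x ^ N)`. -/
theorem norm_sub_integral_exp_pow_le {N : ℕ} (hN : 3 ≤ N) {σ : ℝ} (hσ : |σ| = 1) {L : ℂ}
    (hL : Tendsto (fun T : ℝ => ∫ x in (0 : ℝ)..T,
      Complex.exp (Complex.I * (σ * x ^ N : ℝ))) atTop (𝓝 L)) {S : ℝ} (hS : 0 < S) :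
    ‖(∫ x in (0 : ℝ)..S, Complex.exp (Complex.I * (σ * x ^ N : ℝ))) - L‖ ≤ 2 / S ^ (N - 1) := by
  have hcont : Continuous fun x : ℝ => Complex.exp (Complex.I * (σ * x ^ N : ℝ)) := by fun_prop
  obtain ⟨n, rfl⟩ : ∃ n, N = n + 3 := ⟨N - 3, by omega⟩
  have hσ0 : σ ≠ 0 := by rintro rfl; simp at hσ
  rw [norm_sub_rev]
  refine le_of_tendsto (hL.sub_const _).norm ?_
  filter_upwards [eventually_ge_atTop S] with T hT
  rw [intervalIntegral.integral_interval_sub_left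
    (hcont.intervalIntegrable _ _) (hcont.intervalIntegrable _ _)]
  have key := norm_integral_exp_le (S := S) (T := T) (μ := σ) hT hσ0
    (θ := fun x => x ^ (n + 3)) (θ' := fun x => ((n + 3 : ℕ) : ℝ) * x ^ (n + 2))
    (θ'' := fun x => ((n + 3 : ℕ) : ℝ) * (((n + 2 : ℕ) : ℝ) * x ^ (n + 1)))
    (by fun_prop)
    (fun x _ => (hasDerivAt_pow (n + 3) x).congr_deriv (by simp))
    (fun x _ => ((hasDerivAt_pow (n + 2) x).const_mul _).congr_deriv (by simp))
    (fun x hx => by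
      have : 0 < x := hS.trans_le hx.1
      positivity)
    (fun x hx => by
      have : 0 < x := hS.trans_le hx.1
      positivity)
  refine key.trans ?_
  rw [hσ, one_mul, show n + 3 - 1 = n + 2 by omega]
  gcongr
  push_cast
  have : (1 : ℝ) ≤ n + 3 := by linarith [(Nat.cast_nonneg n : (0 : ℝ) ≤ n)]
  nlinarith [pow_pos hS (n + 2)]

/-- The rescaled form of the tail bound. -/
theorem norm_integral_exp_mul_pow_sub_le {N : ℕ} (hN : 3 ≤ N) {σ : ℝ} (hσ : |σ| = 1) {L : ℂ}
    (hL : Tendsto (fun T : ℝ => ∫ x in (0 : ℝ)..T,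
      Complex.exp (Complex.I * (σ * x ^ N : ℝ))) atTop (𝓝 L)) {S c : ℝ} (hS : 0 < S)
    (hc : 0 < c) :
    ‖(∫ x in (0 : ℝ)..S, Complex.exp (Complex.I * (σ * c ^ N * x ^ N : ℝ))) - (c⁻¹ : ℝ) * L‖ ≤
      2 / (c ^ N * S ^ (N - 1)) := by
  have h1 := intervalIntegral.integral_comp_mul_left (a := 0) (b := S)
    (fun x : ℝ => Complex.exp (Complex.I * (σ * x ^ N : ℝ))) hc.ne'
  have h2 : (∫ x in (0 : ℝ)..S, Complex.exp (Complex.I * (σ * c ^ N * x ^ N : ℝ))) =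
      (c⁻¹ : ℝ) * ∫ x in (0 : ℝ)..c * S, Complex.exp (Complex.I * (σ * x ^ N : ℝ)) := by
    rw [mul_zero] at h1
    rw [← Complex.real_smul, ← h1]
    simp only [mul_pow, mul_assoc]
  rw [h2, ← mul_sub, norm_mul, Complex.norm_real, Real.norm_of_nonneg (inv_pos.2 hc).le]
  have h3 := norm_sub_integral_exp_pow_le hN hσ hL (mul_pos hc hS)
  calc c⁻¹ * _ ≤ c⁻¹ * (2 / (c * S) ^ (N - 1)) := by gcongr
    _ = 2 / (c ^ N * S ^ (N - 1)) := by
      obtain ⟨n, rfl⟩ : ∃ n, N = n + 1 := ⟨N - 1, by omega⟩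
      rw [Nat.add_sub_cancel, mul_pow]
      field_simp
      ring

/-! ### Phases on [0, 1] compared with the model monomial. -/

/-- A chain `f 0, f 1, …, f N` of successive derivatives on `[0, 1]`, vanishing at `0` below
order `N`, with the last one pinched and Hölder continuous at `0`. -/
structure HalfPhase (N : ℕ) (f : ℕ → ℝ → ℝ) (D s : ℝ) : Prop where
  hasDeriv : ∀ j < N, ∀ x ∈ Icc (0 : ℝ) 1,
    HasDerivWithinAt (f j) (f (j + 1) x) (Icc 0 1) x
  zero : ∀ j < N, f j 0 = 0
  bounds : ∀ x ∈ Icc (0 : ℝ) 1, 1 / 10 ≤ f N x ∧ f N x ≤ 10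
  holder : ∀ x ∈ Icc (0 : ℝ) 1, |f N x - f N 0| ≤ D * x ^ s

namespace HalfPhase

variable {N : ℕ} {f : ℕ → ℝ → ℝ} {D s : ℝ}

theorem bounds_zero (H : HalfPhase N f D s) : 1 / 10 ≤ f N 0 ∧ f N 0 ≤ 10 :=
  H.bounds 0 ⟨le_rfl, zero_le_one⟩

theorem nonneg (H : HalfPhase N f D s) : 0 ≤ D := by
  have := (abs_nonneg _).trans (H.holder 1 ⟨zero_le_one, le_rfl⟩)
  simpa using this

theorem hasDerivAt (H : HalfPhase N f D s) {j : ℕ} (hj : j < N) {x : ℝ} (hx : x ∈ Ioo (0 : ℝ) 1) :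
    HasDerivAt (f j) (f (j + 1) x) x :=
  (H.hasDeriv j hj x (Ioo_subset_Icc_self hx)).hasDerivAt (Icc_mem_nhds hx.1 hx.2)

theorem continuousOn (H : HalfPhase N f D s) {j : ℕ} (hj : j < N) :
    ContinuousOn (f j) (Icc 0 1) :=
  fun x hx => (H.hasDeriv j hj x hx).continuousWithinAt

theorem lower (H : HalfPhase N f D s) {j m : ℕ} (hj : j + m = N) {x : ℝ}
    (hx : x ∈ Icc (0 : ℝ) 1) : 1 / 10 * (x ^ m / m.factorial) ≤ f j x :=
  mul_pow_div_factorial_le H.hasDeriv H.zero (fun x hx => (H.bounds x hx).1) m j hj x hx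

theorem upper (H : HalfPhase N f D s) {j m : ℕ} (hj : j + m = N) {x : ℝ}
    (hx : x ∈ Icc (0 : ℝ) 1) : f j x ≤ 10 * (x ^ m / m.factorial) :=
  le_mul_pow_div_factorial H.hasDeriv H.zero (fun x hx => (H.bounds x hx).2) m j hj x hx

theorem pos (H : HalfPhase N f D s) {j : ℕ} (hj : j ≤ N) {x : ℝ}
    (hx : x ∈ Ioc (0 : ℝ) 1) : 0 < f j x := by
  refine lt_of_lt_of_le ?_ (H.lower (Nat.add_sub_cancel' hj) (Ioc_subset_Icc_self hx))
  have := hx.1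
  positivity

/-- Comparison of the derivatives with those of the model monomial. -/
theorem exists_ratio (H : HalfPhase N f D s) (hs : 0 ≤ s) {j m : ℕ} (hj : j + m = N) {x : ℝ}
    (hx : x ∈ Ioc (0 : ℝ) 1) : ∃ u ∈ Icc (1 / 100 : ℝ) 100, |u - 1| ≤ 10 * (D * x ^ s) ∧
      f j x = f N 0 * (x ^ m / m.factorial) * u := by
  have hx' := Ioc_subset_Icc_self hx
  have hx0 := hx.1
  have hb := H.bounds_zero
  have hsub : Icc 0 x ⊆ Icc (0 : ℝ) 1 := Icc_subset_Icc_right hx.2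
  have hd : ∀ j < N, ∀ y ∈ Icc 0 x, HasDerivWithinAt (f j) (f (j + 1) y) (Icc 0 x) y :=
    fun j hj y hy => (H.hasDeriv j hj y (hsub hy)).mono hsub
  have hη : ∀ y ∈ Icc 0 x, |f N y - f N 0| ≤ D * x ^ s := fun y hy =>
    (H.holder y (hsub hy)).trans
      (mul_le_mul_of_nonneg_left (Real.rpow_le_rpow hy.1 hy.2 hs) H.nonneg)
  have hxx : x ∈ Icc 0 x := ⟨hx0.le, le_rfl⟩
  -- The Taylor bounds are used twice: the absolute pinching confines `u` to [1/100, 100], while on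
  -- [0, x] the top derivative lies within `D x^s` of `f N 0 ≥ 1/10`, which gives the closeness to
  -- 1.
  have h1 := H.lower hj hx'
  have h2 := H.upper hj hx'
  have h3 := le_mul_pow_div_factorial (B := f N 0 + D * x ^ s) hd H.zero
    (fun y hy => by linarith [(abs_le.1 (hη y hy)).2]) m j hj x hxx
  have h4 := mul_pow_div_factorial_le (B := f N 0 - D * x ^ s) hd H.zero
    (fun y hy => by linarith [(abs_le.1 (hη y hy)).1]) m j hj x hxx
  have hη0 : 0 ≤ D * x ^ s := mul_nonneg H.nonneg (Real.rpow_nonneg hx0.le _)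
  set p := x ^ m / (m.factorial : ℝ) with hp
  set η := D * x ^ s with hηd
  set b := f N 0 with hbd
  have hp0 : 0 < p := by positivity
  have hb0 : 0 < b := by linarith [hb.1]
  have hbp : 0 < b * p := mul_pos hb0 hp0
  refine ⟨f j x / (b * p), ⟨?_, ?_⟩, ?_, by field_simp⟩
  · rw [le_div_iff₀ hbp]; nlinarith [hb.2]
  · rw [div_le_iff₀ hbp]; nlinarith [hb.1]
  · rw [div_sub_one hbp.ne', abs_div, abs_of_pos hbp, div_le_iff₀ hbp]
    have : η * p ≤ 10 * η * (b * p) := by nlinarith [hb.1, mul_nonneg hη0 hp0.le]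
    rw [abs_le]
    constructor <;> nlinarith

end HalfPhase

/-! ### The normalizing coordinate and its derivatives. -/

/-- The coefficient of the model monomial. -/
noncomputable def lead (N : ℕ) (f : ℕ → ℝ → ℝ) : ℝ := f N 0 / N.factorial

/-- The derivative of the normalizing coordinate `(f 0 / lead N f) ^ (1 / N)`. -/
noncomputable def jac (N : ℕ) (f : ℕ → ℝ → ℝ) (x : ℝ) : ℝ :=
  (f 0 x / lead N f) ^ (1 / (N : ℝ) - 1) * (f 1 x / (N * lead N f))

/-- The second derivative of the normalizing coordinate. -/
noncomputable def jac' (N : ℕ) (f : ℕ → ℝ → ℝ) (x : ℝ) : ℝ :=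
  (f 1 x / lead N f * (1 / (N : ℝ) - 1) * (f 0 x / lead N f) ^ (1 / (N : ℝ) - 1 - 1)) *
      (f 1 x / (N * lead N f)) +
    (f 0 x / lead N f) ^ (1 / (N : ℝ) - 1) * (f 2 x / (N * lead N f))

namespace HalfPhase

variable {N : ℕ} {f : ℕ → ℝ → ℝ} {D s : ℝ}

theorem lead_pos (H : HalfPhase N f D s) : 0 < lead N f := by
  have := H.bounds_zero
  have : 0 < f N 0 := by linarith
  unfold lead; positivity

theorem one_le_mul_lead (H : HalfPhase N f D s) : 1 ≤ 10 * N.factorial * lead N f := by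
  have := H.bounds_zero
  unfold lead
  field_simp
  linarith

theorem hasDerivAt_coord (H : HalfPhase N f D s) (hN : 3 ≤ N) {x : ℝ} (hx : x ∈ Ioo (0 : ℝ) 1) :
    HasDerivAt (fun x => (f 0 x / lead N f) ^ (1 / (N : ℝ))) (jac N f x) x := by
  have h0 := H.pos (Nat.zero_le _) (Ioo_subset_Ioc_self hx)
  have ha := H.lead_pos
  have := ((H.hasDerivAt (by omega : 0 < N) hx).div_const (lead N f)).rpow_const
    (p := 1 / (N : ℝ)) (Or.inl (div_pos h0 ha).ne')
  refine this.congr_deriv ?_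
  unfold jac
  have : (N : ℝ) ≠ 0 := by positivity
  field_simp

theorem hasDerivAt_jac (H : HalfPhase N f D s) (hN : 3 ≤ N) {x : ℝ} (hx : x ∈ Ioo (0 : ℝ) 1) :
    HasDerivAt (jac N f) (jac' N f x) x := by
  have h0 := H.pos (Nat.zero_le _) (Ioo_subset_Ioc_self hx)
  have ha := H.lead_pos
  have h1 := ((H.hasDerivAt (by omega : 0 < N) hx).div_const (lead N f)).rpow_const
    (p := 1 / (N : ℝ) - 1) (Or.inl (div_pos h0 ha).ne')
  exact h1.mul ((H.hasDerivAt (by omega : 1 < N) hx).div_const _)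

theorem continuousOn_rpow (H : HalfPhase N f D s) (hN : 3 ≤ N) (α : ℝ) :
    ContinuousOn (fun x => (f 0 x / lead N f) ^ α) (Ioc 0 1) := by
  refine ContinuousOn.rpow_const
    (((H.continuousOn (by omega : 0 < N)).mono Ioc_subset_Icc_self).div_const _) fun x hx => ?_
  exact Or.inl (div_pos (H.pos (Nat.zero_le _) hx) H.lead_pos).ne'

theorem continuousOn_jac (H : HalfPhase N f D s) (hN : 3 ≤ N) :
    ContinuousOn (jac N f) (Ioc 0 1) :=
  (H.continuousOn_rpow hN _).mul
    (((H.continuousOn (by omega : 1 < N)).mono Ioc_subset_Icc_self).div_const _)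

theorem continuousOn_jac' (H : HalfPhase N f D s) (hN : 3 ≤ N) :
    ContinuousOn (jac' N f) (Ioc 0 1) := by
  have h1 := (H.continuousOn (by omega : 1 < N)).mono Ioc_subset_Icc_self
  have h2 := (H.continuousOn (by omega : 2 < N)).mono Ioc_subset_Icc_self
  exact ((((h1.div_const _).mul_const _).mul (H.continuousOn_rpow hN _)).mul (h1.div_const _)).add
    ((H.continuousOn_rpow hN _).mul (h2.div_const _))

/-- The normalizing coordinate is close to `x`, to second order. -/
theorem exists_jac_bound (hN : 3 ≤ N) : ∃ C : ℝ, 1 ≤ C ∧ ∀ (f : ℕ → ℝ → ℝ) (D s : ℝ),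
    HalfPhase N f D s → 0 ≤ s → ∀ x ∈ Ioc (0 : ℝ) 1,
      |jac N f x - 1| ≤ C * (D * x ^ s) ∧ |jac' N f x| ≤ C * (D * x ^ s / x) := by
  obtain ⟨L, hL0, hL⟩ := exists_abs_rpow_sub_one_le (1 / (N : ℝ) - 1)
  obtain ⟨L', hL0', hL'⟩ := exists_abs_rpow_sub_one_le (1 / (N : ℝ) - 1 - 1)
  refine ⟨1 + 10 * (100 * L + 1) + N * (10 * (100 * L + 1) + 10 * (10000 * L' + 101)),
    by have : (0:ℝ) ≤ N := Nat.cast_nonneg _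
       have : 0 ≤ N * (10 * (100 * L + 1) + 10 * (10000 * L' + 101)) := by positivity
       linarith, fun f D s H hs x hx => ?_⟩
  obtain ⟨n, rfl⟩ : ∃ n, N = n + 3 := ⟨N - 3, by omega⟩
  obtain ⟨u, hu, hu1, hfu⟩ := H.exists_ratio hs (Nat.zero_add _) hx
  obtain ⟨v, hv, hv1, hfv⟩ := H.exists_ratio hs (by omega : 1 + (n + 2) = n + 3) hx
  obtain ⟨w, hw, hw1, hfw⟩ := H.exists_ratio hs (by omega : 2 + (n + 1) = n + 3) hx
  have hx0 := hx.1
  have ha := H.lead_pos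
  have hu0 : 0 < u := by linarith [hu.1]
  have hNr : (0 : ℝ) < ((n + 3 : ℕ) : ℝ) := by positivity
  have hb : f (n + 3) 0 = lead (n + 3) f * ((n + 3).factorial : ℕ) := by
    unfold lead; field_simp
  have hE : 0 ≤ D * x ^ s := mul_nonneg H.nonneg (Real.rpow_nonneg hx0.le _)
  set E := D * x ^ s with hEd
  have f3 : ((n + 3).factorial : ℝ) = ((n + 3 : ℕ) : ℝ) * (n + 2).factorial := by
    exact_mod_cast Nat.factorial_succ (n + 2)
  have f2 : ((n + 2).factorial : ℝ) = ((n + 2 : ℕ) : ℝ) * (n + 1).factorial := by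
    exact_mod_cast Nat.factorial_succ (n + 1)
  have e0 : f 0 x / lead (n + 3) f = x ^ (n + 3) * u := by
    rw [hfu, hb]; field_simp
  have e1 : f 1 x / lead (n + 3) f = ((n + 3 : ℕ) : ℝ) * x ^ (n + 2) * v := by
    rw [hfv, hb, f3]; field_simp
  have e1' : f 1 x / (((n + 3 : ℕ) : ℝ) * lead (n + 3) f) = x ^ (n + 2) * v := by
    rw [hfv, hb, f3]; field_simp
  have e2 : f 2 x / (((n + 3 : ℕ) : ℝ) * lead (n + 3) f) = ((n + 2 : ℕ) : ℝ) * x ^ (n + 1) * w := by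
    rw [hfw, hb, f3, f2]; field_simp
  have hroot : (x ^ (n + 3)) ^ (1 / ((n + 3 : ℕ) : ℝ)) = x := by
    rw [one_div]; exact Real.pow_rpow_inv_natCast hx0.le (by omega)
  have hxp : 0 < x ^ (n + 3) := by positivity
  have r1 : (x ^ (n + 3) * u) ^ (1 / ((n + 3 : ℕ) : ℝ) - 1) =
      x / x ^ (n + 3) * u ^ (1 / ((n + 3 : ℕ) : ℝ) - 1) := by
    rw [Real.mul_rpow hxp.le hu0.le, Real.rpow_sub_one hxp.ne', hroot]
  have r2 : (x ^ (n + 3) * u) ^ (1 / ((n + 3 : ℕ) : ℝ) - 1 - 1) =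
      x / x ^ (n + 3) / x ^ (n + 3) * u ^ (1 / ((n + 3 : ℕ) : ℝ) - 1 - 1) := by
    rw [Real.mul_rpow hxp.le hu0.le, Real.rpow_sub_one hxp.ne', Real.rpow_sub_one hxp.ne', hroot]
  have hj : jac (n + 3) f x = u ^ (1 / ((n + 3 : ℕ) : ℝ) - 1) * v := by
    unfold jac
    rw [e0, e1', r1]
    field_simp
    ring
  -- For an exact monomial `u = v = w = 1` and the bracket vanishes. In general it is a difference
  -- of two quantities that are each 1 + O(D x^s).
  have hj' : jac' (n + 3) f x = ((n + 2 : ℕ) : ℝ) / x *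
      (u ^ (1 / ((n + 3 : ℕ) : ℝ) - 1) * w - u ^ (1 / ((n + 3 : ℕ) : ℝ) - 1 - 1) * v ^ 2) := by
    unfold jac'
    rw [e0, e1, e1', e2, r1, r2]
    push_cast
    field_simp
    ring
  have hA := hL u hu
  have hA' := hL' u hu
  set A := u ^ (1 / ((n + 3 : ℕ) : ℝ) - 1)
  set A' := u ^ (1 / ((n + 3 : ℕ) : ℝ) - 1 - 1)
  have hAE : |A - 1| ≤ L * (10 * E) := hA.trans (by gcongr)
  have hAE' : |A' - 1| ≤ L' * (10 * E) := hA'.trans (by gcongr)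
  have hgen : ∀ z ∈ Icc (1 / 100 : ℝ) 100, |z - 1| ≤ 10 * E →
      |A * z - 1| ≤ 10 * (100 * L + 1) * E := by
    intro z hz hz1
    calc |A * z - 1| = |(A - 1) * z + (z - 1)| := by ring_nf
      _ ≤ |A - 1| * |z| + |z - 1| := by
        refine (abs_add_le _ _).trans (by rw [abs_mul])
      _ ≤ L * (10 * E) * 100 + 10 * E := by
        gcongr
        rw [abs_of_pos (by linarith [hz.1])]; exact hz.2
      _ = _ := by ring
  have hsq : |A' * v ^ 2 - 1| ≤ 10 * (10000 * L' + 101) * E := by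
    calc |A' * v ^ 2 - 1| = |(A' - 1) * v ^ 2 + (v - 1) * (v + 1)| := by ring_nf
      _ ≤ |A' - 1| * |v ^ 2| + |v - 1| * |v + 1| := by
        refine (abs_add_le _ _).trans (by rw [abs_mul, abs_mul])
      _ ≤ L' * (10 * E) * 10000 + 10 * E * 101 := by
        gcongr
        · rw [abs_of_nonneg (sq_nonneg v)]; nlinarith [hv.1, hv.2]
        · rw [abs_of_pos (by linarith [hv.1])]; linarith [hv.2]
      _ = _ := by ring
  have hv2 := hgen v hv hv1
  have hw2 := hgen w hw hw1
  constructor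
  · rw [hj]
    refine hv2.trans (mul_le_mul_of_nonneg_right ?_ hE)
    have : 0 ≤ ((n + 3 : ℕ) : ℝ) * (10 * (100 * L + 1) + 10 * (10000 * L' + 101)) := by positivity
    linarith
  · rw [hj', abs_mul, abs_of_nonneg (by positivity)]
    have h1 : |A * w - A' * v ^ 2| ≤ (10 * (100 * L + 1) + 10 * (10000 * L' + 101)) * E := by
      calc |A * w - A' * v ^ 2| = |(A * w - 1) - (A' * v ^ 2 - 1)| := by ring_nf
        _ ≤ _ := (abs_sub _ _).trans (by linarith)
    calc ((n + 2 : ℕ) : ℝ) / x * |A * w - A' * v ^ 2|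
        ≤ ((n + 3 : ℕ) : ℝ) / x * ((10 * (100 * L + 1) + 10 * (10000 * L' + 101)) * E) := by
          gcongr; omega
      _ = ((n + 3 : ℕ) : ℝ) * (10 * (100 * L + 1) + 10 * (10000 * L' + 101)) * (E / x) := by ring
      _ ≤ _ := by
        refine mul_le_mul_of_nonneg_right ?_ (by positivity)
        have : 0 ≤ 10 * (100 * L + 1) := by positivity
        linarith

end HalfPhase
-- Oscillatory integrals with an amplitude vanishing at 0.
theorem norm_exp_I_mul (t : ℝ) : ‖Complex.exp (Complex.I * (t : ℝ))‖ = 1 := by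
  rw [mul_comm]; exact Complex.norm_exp_ofReal_mul_I t

/-- The integral is `(q - 1) / (N - 1 - s)` with `q` the right-hand side, and `N - 1 - s ≥ 1`. -/
theorem integral_rpow_div_pow_le {N : ℕ} (hN : 3 ≤ N) {s δ : ℝ} (hs1 : s ≤ 1)
    (hδ : 0 < δ) (hδ1 : δ ≤ 1) :
    ∫ x in δ..1, x ^ s / x ^ N ≤ δ ^ s / δ ^ (N - 1) := by
  have hN' : (3 : ℝ) ≤ N := by exact_mod_cast hN
  have h1 : ∫ x in δ..1, x ^ s / x ^ N = ∫ x in δ..1, x ^ (s - N) := by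
    apply intervalIntegral.integral_congr
    intro x hx
    rw [uIcc_of_le hδ1] at hx
    exact (Real.rpow_sub_natCast (hδ.trans_le hx.1).ne' _ _).symm
  have h0 : (0 : ℝ) ∉ uIcc δ 1 := by
    rw [uIcc_of_le hδ1]; exact fun h => absurd h.1 (not_le.2 hδ)
  rw [h1, integral_rpow (Or.inr ⟨by linarith, h0⟩), Real.one_rpow]
  have h2 : δ ^ (s - N + 1) = δ ^ s / δ ^ (N - 1) := by
    rw [show s - N + 1 = s - (N - 1 : ℕ) by rw [Nat.cast_sub (by omega)]; push_cast; ring]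
    exact Real.rpow_sub_natCast hδ.ne' _ _
  rw [h2]
  have h3 : 0 ≤ δ ^ s / δ ^ (N - 1) := by positivity
  rw [div_le_iff_of_neg (by linarith)]
  nlinarith

/-- An amplitude vanishing to order `s` at the degenerate critical point gains `δ ^ s`. -/
theorem HalfPhase.norm_integral_le {N : ℕ} {f : ℕ → ℝ → ℝ} {D s : ℝ} (H : HalfPhase N f D s)
    (hN : 3 ≤ N) (hs : 0 ≤ s) (hs1 : s ≤ 1) {δ μ A : ℝ} (hδ : 0 < δ) (hδ1 : δ ≤ 1)
    (hμ : |μ| * δ ^ N = 1) {h h' : ℝ → ℂ} (hA : 0 ≤ A)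
    (hc : ContinuousOn h (Ioc 0 1)) (hc' : ContinuousOn h' (Ioc 0 1))
    (dh : ∀ x ∈ Ioo (0 : ℝ) 1, HasDerivAt h (h' x) x)
    (hb : ∀ x ∈ Ioc (0 : ℝ) 1, ‖h x‖ ≤ A * x ^ s)
    (hb' : ∀ x ∈ Ioc (0 : ℝ) 1, ‖h' x‖ ≤ A * (x ^ s / x)) :
    ‖∫ x in (0 : ℝ)..1, Complex.exp (Complex.I * (μ * f 0 x : ℝ)) * h x‖ ≤
      A * (1 + 30 * N.factorial + 1000 * N.factorial ^ 2) * (δ * δ ^ s) := by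
  obtain ⟨n, rfl⟩ : ∃ n, N = n + 3 := ⟨N - 3, by omega⟩
  have hμ0 : μ ≠ 0 := by rintro rfl; simp at hμ
  set F : ℝ := ((n + 3).factorial : ℝ) with hF
  have hF1 : ((n + 2).factorial : ℝ) ≤ F := by
    rw [hF]; exact_mod_cast Nat.factorial_le (by omega : n + 2 ≤ n + 3)
  have hF0 : 0 < F := by positivity
  have hsub : Icc δ 1 ⊆ Ioc (0 : ℝ) 1 := fun x hx => ⟨hδ.trans_le hx.1, hx.2⟩
  have hsubI : Icc δ 1 ⊆ Icc (0 : ℝ) 1 := fun x hx => ⟨hδ.le.trans hx.1, hx.2⟩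
  have hsubo : Ioo δ 1 ⊆ Ioo (0 : ℝ) 1 := fun x hx => ⟨hδ.trans hx.1, hx.2⟩
  set g : ℝ → ℂ := fun x => Complex.exp (Complex.I * (μ * f 0 x : ℝ)) * h x with hg
  have hgc : ContinuousOn g (Ioc 0 1) := by
    refine ContinuousOn.mul ?_ hc
    apply Complex.continuous_exp.comp_continuousOn
    exact continuousOn_const.mul (Complex.continuous_ofReal.comp_continuousOn
      (continuousOn_const.mul ((H.continuousOn (by omega : 0 < n + 3)).mono Ioc_subset_Icc_self)))
  have hgn : ∀ x, ‖g x‖ = ‖h x‖ := fun x => by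
    rw [hg]; simp only; rw [norm_mul, norm_exp_I_mul, one_mul]
  have hgA : ∀ x ∈ Ioc (0 : ℝ) 1, ‖g x‖ ≤ A := fun x hx => by
    rw [hgn]
    exact (hb x hx).trans (mul_le_of_le_one_right hA (Real.rpow_le_one hx.1.le hx.2 hs))
  -- Continuity of `h` is known only away from 0, so integrability comes from boundedness.
  have hgi : IntervalIntegrable g volume 0 1 := by
    rw [intervalIntegrable_iff_integrableOn_Ioc_of_le zero_le_one]
    exact IntegrableOn.of_bound (by simp) (hgc.aestronglyMeasurable measurableSet_Ioc) A
      ((ae_restrict_iff' measurableSet_Ioc).2 (Eventually.of_forall hgA))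
  have hm0 : uIcc 0 δ ⊆ uIcc (0 : ℝ) 1 := by
    rw [uIcc_of_le hδ.le, uIcc_of_le zero_le_one]; exact Icc_subset_Icc_right hδ1
  have hm1 : uIcc δ 1 ⊆ uIcc (0 : ℝ) 1 := by
    rw [uIcc_of_le hδ1, uIcc_of_le zero_le_one]; exact hsubI
  have near : ‖∫ x in (0 : ℝ)..δ, g x‖ ≤ A * δ ^ s * δ := by
    have := intervalIntegral.norm_integral_le_of_norm_le_const (a := 0) (b := δ) (f := g)
      (C := A * δ ^ s) fun x hx => by
        rw [uIoc_of_le hδ.le] at hx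
        rw [hgn]
        refine (hb x ⟨hx.1, hx.2.trans hδ1⟩).trans ?_
        exact mul_le_mul_of_nonneg_left (Real.rpow_le_rpow hx.1.le hx.2 hs) hA
    rwa [sub_zero, abs_of_pos hδ] at this
  have flow : ∀ x ∈ Ioc (0 : ℝ) 1, x ^ (n + 2) / (10 * F) ≤ f 1 x := by
    intro x hx
    refine le_trans ?_ (H.lower (by omega : 1 + (n + 2) = n + 3) (Ioc_subset_Icc_self hx))
    have := hx.1
    rw [div_mul_div_comm, one_mul]
    gcongr
  have inv1 : ∀ x ∈ Ioc (0 : ℝ) 1, 1 / f 1 x ≤ 10 * F / x ^ (n + 2) := by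
    intro x hx
    have h1 := flow x hx
    have h2 : 0 < x ^ (n + 2) := pow_pos hx.1 _
    rw [div_le_div_iff₀ (H.pos (by omega) hx) h2]
    rw [div_le_iff₀ (by positivity)] at h1
    linarith
  have up2 : ∀ x ∈ Ioc (0 : ℝ) 1, |f 2 x| ≤ 10 * x ^ (n + 1) := by
    intro x hx
    rw [abs_of_pos (H.pos (by omega) hx)]
    refine (H.upper (by omega : 2 + (n + 1) = n + 3) (Ioc_subset_Icc_self hx)).trans ?_
    gcongr
    refine div_le_self (pow_nonneg hx.1.le _) ?_
    exact_mod_cast Nat.one_le_iff_ne_zero.2 (Nat.factorial_ne_zero _)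
  have bdry : ∀ x ∈ Ioc (0 : ℝ) 1, ‖h x‖ / f 1 x ≤ A * (10 * F) * (x ^ s / x ^ (n + 2)) := by
    intro x hx
    have := hx.1
    calc ‖h x‖ / f 1 x = ‖h x‖ * (1 / f 1 x) := by ring
      _ ≤ (A * x ^ s) * (10 * F / x ^ (n + 2)) := by
        refine mul_le_mul (hb x hx) (inv1 x hx) ?_ (by positivity)
        exact (one_div_pos.2 (H.pos (by omega) hx)).le
      _ = _ := by ring
  have hsc : ContinuousOn (fun x : ℝ => A * (10 * F + 1000 * F ^ 2) * (x ^ s / x ^ (n + 3)))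
      (Icc δ 1) := by
    refine continuousOn_const.mul (ContinuousOn.div ?_ (by fun_prop) fun x hx => ?_)
    · exact continuousOn_id.rpow_const fun x _ => Or.inr hs
    · exact pow_ne_zero _ (hδ.trans_le hx.1).ne'
  -- Both `h' / θ'` and `h θ'' / θ'^2` are O(x^(s-N)). The lower bound on `f 1` costs `10 F` once in
  -- the first and twice in the second, where `f 2` adds another 10.
  have far := norm_integral_exp_mul_le (S := δ) (T := 1) (μ := μ) (θ := f 0) (θ' := f 1)
    (θ'' := f 2) (h := h) (h' := h')
    (B := fun x : ℝ => A * (10 * F + 1000 * F ^ 2) * (x ^ s / x ^ (n + 3))) hδ1 hμ0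
    ((H.continuousOn (by omega)).mono hsubI) ((H.continuousOn (by omega)).mono hsubI)
    ((H.continuousOn (by omega)).mono hsubI) (hc.mono hsub) (hc'.mono hsub)
    (fun x hx => H.hasDerivAt (by omega) (hsubo hx))
    (fun x hx => H.hasDerivAt (by omega) (hsubo hx)) (fun x hx => dh x (hsubo hx))
    (fun x hx => H.pos (by omega) (hsub hx))
    (fun x hx => by
      have hx1 : x ∈ Ioc (0 : ℝ) 1 := hsub (Ioc_subset_Icc_self hx)
      have hx0 := hx1.1
      have hp := H.pos (by omega : 1 ≤ n + 3) hx1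
      have hinv0 : 0 ≤ 1 / f 1 x := (one_div_pos.2 hp).le
      calc ‖h' x / f 1 x - h x * f 2 x / (f 1 x : ℂ) ^ 2‖
          ≤ ‖h' x / f 1 x‖ + ‖h x * f 2 x / (f 1 x : ℂ) ^ 2‖ := norm_sub_le _ _
        _ = ‖h' x‖ * (1 / f 1 x) + ‖h x‖ * |f 2 x| * (1 / f 1 x) ^ 2 := by
          rw [norm_div, norm_div, norm_mul, norm_pow, Complex.norm_real, Complex.norm_real,
            Real.norm_eq_abs, Real.norm_eq_abs, abs_of_pos hp]
          ring
        _ ≤ (A * (x ^ s / x)) * (10 * F / x ^ (n + 2)) +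
            (A * x ^ s) * (10 * x ^ (n + 1)) * (10 * F / x ^ (n + 2)) ^ 2 := by
          have i1 := inv1 x hx1
          have i2 := hb x hx1
          have i3 := hb' x hx1
          have i4 := up2 x hx1
          gcongr
        _ = _ := by
          field_simp
          ring)
    (hsc.intervalIntegrable_of_Icc hδ1)
  rw [intervalIntegral.integral_const_mul] at far
  have hint := integral_rpow_div_pow_le hN hs1 hδ hδ1
  rw [show n + 3 - 1 = n + 2 by omega] at hint
  set q := δ ^ s / δ ^ (n + 2) with hq
  have hq0 : 0 ≤ q := by positivity
  have hmuinv : 1 / |μ| = δ ^ (n + 3) := by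
    rw [div_eq_iff (abs_pos.2 hμ0).ne', mul_comm]; exact hμ.symm
  have hq1 : 1 ≤ q := by
    -- As `q ≥ 1`, the boundary term at 1 is absorbed by the one at `δ`; multiplying `q` by `1 / |μ|
    -- = δ^N` then produces `δ^(1+s)`.
    rw [hq, one_le_div (by positivity), ← Real.rpow_natCast]
    apply Real.rpow_le_rpow_of_exponent_ge hδ hδ1
    push_cast
    linarith [(Nat.cast_nonneg n : (0 : ℝ) ≤ n)]
  have b1 := bdry δ ⟨hδ, hδ1⟩
  have b2 := bdry 1 ⟨zero_lt_one, le_rfl⟩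
  rw [Real.one_rpow, one_pow, div_one, mul_one] at b2
  have far' : ‖∫ x in δ..1, g x‖ ≤ A * (30 * F + 1000 * F ^ 2) * (δ * δ ^ s) := by
    refine far.trans ?_
    rw [div_eq_mul_one_div, hmuinv]
    have e1 : ‖h δ‖ / f 1 δ + ‖h 1‖ / f 1 1 +
        A * (10 * F + 1000 * F ^ 2) * ∫ x in δ..1, x ^ s / x ^ (n + 3) ≤
        A * (30 * F + 1000 * F ^ 2) * q := by
      have i1 : A * (10 * F + 1000 * F ^ 2) * ∫ x in δ..1, x ^ s / x ^ (n + 3) ≤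
          A * (10 * F + 1000 * F ^ 2) * q := by gcongr
      have i2 : A * (10 * F) ≤ A * (10 * F) * q := le_mul_of_one_le_right (by positivity) hq1
      linarith
    calc _ ≤ A * (30 * F + 1000 * F ^ 2) * q * δ ^ (n + 3) := by gcongr
      _ = _ := by rw [hq]; field_simp; ring
  rw [← intervalIntegral.integral_add_adjacent_intervals (hgi.mono_set hm0) (hgi.mono_set hm1)]
  refine (norm_add_le _ _).trans ((add_le_add near far').trans (le_of_eq ?_))
  ring

/-- The change of variables to the normalizing coordinate. -/
theorem HalfPhase.integral_exp_mul_jac {N : ℕ} {f : ℕ → ℝ → ℝ} {D s : ℝ} (H : HalfPhase N f D s)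
    (hN : 3 ≤ N) {B : ℝ} (hB : ∀ x ∈ Ioc (0 : ℝ) 1, |jac N f x| ≤ B) (μ : ℝ) :
    IntervalIntegrable (fun x => Complex.exp (Complex.I * (μ * f 0 x : ℝ)) * jac N f x) volume 0 1 ∧
    ∫ x in (0 : ℝ)..1, Complex.exp (Complex.I * (μ * f 0 x : ℝ)) * jac N f x =
      ∫ y in (0 : ℝ)..(f 0 1 / lead N f) ^ (1 / (N : ℝ)),
        Complex.exp (Complex.I * (μ * lead N f * y ^ N : ℝ)) := by
  have ha := H.lead_pos
  have hf0 := H.continuousOn (by omega : 0 < N)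
  have hint : IntervalIntegrable (fun x => Complex.exp (Complex.I * (μ * f 0 x : ℝ)) * jac N f x)
      volume 0 1 := by
    rw [intervalIntegrable_iff_integrableOn_Ioc_of_le zero_le_one]
    refine IntegrableOn.of_bound (by simp)
      (ContinuousOn.aestronglyMeasurable (ContinuousOn.mul ?_ ?_) measurableSet_Ioc) B
      ((ae_restrict_iff' measurableSet_Ioc).2 (Eventually.of_forall fun x hx => ?_))
    · apply Complex.continuous_exp.comp_continuousOn
      exact continuousOn_const.mul (Complex.continuous_ofReal.comp_continuousOn
        (continuousOn_const.mul (hf0.mono Ioc_subset_Icc_self)))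
    · exact Complex.continuous_ofReal.comp_continuousOn (H.continuousOn_jac hN)
    · rw [norm_mul, norm_exp_I_mul, one_mul, Complex.norm_real]; exact hB x hx
  refine ⟨hint, ?_⟩
  set e : ℝ → ℂ := fun y => Complex.exp (Complex.I * (μ * lead N f * y ^ N : ℝ)) with he
  have hec : Continuous e := by fun_prop
  have hP : ∀ z, HasDerivAt (fun z => ∫ y in (0 : ℝ)..z, e y) (e z) z := fun z =>
    intervalIntegral.integral_hasDerivAt_right (hec.intervalIntegrable _ _)
      (hec.stronglyMeasurableAtFilter _ _) hec.continuousAt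
  have hPc : Continuous (fun z => ∫ y in (0 : ℝ)..z, e y) :=
    continuous_iff_continuousAt.2 fun z => (hP z).continuousAt
  -- The primitive of the model integrand is composed with the coordinate. Continuity up to 0 is
  -- enough there, since the coordinate need only be differentiable inside.
  have key := intervalIntegral.integral_eq_sub_of_hasDerivAt_of_le
    (f := fun x => ∫ y in (0 : ℝ)..(f 0 x / lead N f) ^ (1 / (N : ℝ)), e y)
    (f' := fun x => Complex.exp (Complex.I * (μ * f 0 x : ℝ)) * jac N f x) zero_le_one
    (hPc.comp_continuousOn ((hf0.div_const _).rpow_const fun x _ => Or.inr (by positivity)))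
    (fun x hx => by
      have h0 := H.pos (Nat.zero_le _) (Ioo_subset_Ioc_self hx)
      have h1 := (hP _).scomp x (H.hasDerivAt_coord hN hx)
      refine h1.congr_deriv ?_
      rw [Complex.real_smul, mul_comm, he]
      simp only
      rw [one_div, Real.rpow_inv_natCast_pow (div_pos h0 ha).le (by omega)]
      congr 4
      field_simp)
    hint
  rw [key, H.zero 0 (by omega), zero_div, Real.zero_rpow (by positivity)]
  simp

/-! ### Half-line asymptotics. -/

theorem norm_sub_le_of_deriv_bound {ψ ψ' : ℝ → ℂ} {M' : ℝ} (dψ : ∀ x, HasDerivAt ψ (ψ' x) x)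
    (hψ' : ∀ x ∈ Icc (0 : ℝ) 1, ‖ψ' x‖ ≤ M') {x y : ℝ} (hx : x ∈ Icc (0 : ℝ) 1)
    (hy : y ∈ Icc (0 : ℝ) 1) : ‖ψ y - ψ x‖ ≤ M' * |y - x| :=
  (convex_Icc (0 : ℝ) 1).norm_image_sub_le_of_norm_hasDerivWithin_le
    (fun z _ => (dψ z).hasDerivWithinAt) hψ' hx hy

theorem rpow_one_div_le {N : ℕ} (hN : 3 ≤ N) {t B : ℝ} (ht : 0 ≤ t) (htB : t ≤ B) (hB : 1 ≤ B) :
    t ^ (1 / (N : ℝ)) ≤ B := by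
  have hN' : (3 : ℝ) ≤ N := by exact_mod_cast hN
  calc t ^ (1 / (N : ℝ)) ≤ B ^ (1 / (N : ℝ)) := by gcongr
    _ ≤ B ^ (1 : ℝ) := Real.rpow_le_rpow_of_exponent_le hB
        ((div_le_one (by linarith)).2 (by linarith))
    _ = B := Real.rpow_one B

/-- Half-line asymptotics for large parameters. -/
theorem exists_half_bound_of_one_le {N : ℕ} (hN : 3 ≤ N) : ∃ C : ℝ, 0 ≤ C ∧
    ∀ (f : ℕ → ℝ → ℝ) (D s σ l M M' : ℝ) (ψ ψ' : ℝ → ℂ) (L : ℂ),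
      HalfPhase N f D s → 0 ≤ s → s ≤ 1 → |σ| = 1 → 1 ≤ l →
      Tendsto (fun T : ℝ => ∫ x in (0 : ℝ)..T,
        Complex.exp (Complex.I * (σ * x ^ N : ℝ))) atTop (𝓝 L) →
      (∀ x, HasDerivAt ψ (ψ' x) x) → Continuous ψ' →
      (∀ x ∈ Icc (0 : ℝ) 1, ‖ψ x‖ ≤ M) → (∀ x ∈ Icc (0 : ℝ) 1, ‖ψ' x‖ ≤ M') → ψ 1 = 0 →
      ‖(∫ x in (0 : ℝ)..1, Complex.exp (Complex.I * (σ * l * f 0 x : ℝ)) * ψ x) -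
          ψ 0 * ((((l * lead N f) ^ (1 / (N : ℝ)))⁻¹ : ℝ) * L)‖ ≤
        C * (l ^ (-(1 / (N : ℝ))) * (l ^ (-(1 / (N : ℝ)))) ^ s) * (M' + D * M) := by
  obtain ⟨C, hC1, hC⟩ := HalfPhase.exists_jac_bound hN
  set F : ℝ := (N.factorial : ℝ) with hF
  have hF0 : 0 < F := by positivity
  refine ⟨C * (1 + 30 * F + 1000 * F ^ 2) + 200000 * F, by positivity, ?_⟩
  intro f D s σ l M M' ψ ψ' L H hs hs1 hσ hl hL dψ hψ'c hψ hψ' hψ1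
  have hl0 : 0 < l := by linarith
  have ha := H.lead_pos
  have hD := H.nonneg
  have h00 : (0 : ℝ) ∈ Icc (0 : ℝ) 1 := ⟨le_rfl, zero_le_one⟩
  have h11 : (1 : ℝ) ∈ Icc (0 : ℝ) 1 := ⟨zero_le_one, le_rfl⟩
  have hM : 0 ≤ M := (norm_nonneg _).trans (hψ 0 h00)
  have hM' : 0 ≤ M' := (norm_nonneg _).trans (hψ' 0 h00)
  set δ := l ^ (-(1 / (N : ℝ))) with hδd
  have hδ : 0 < δ := Real.rpow_pos_of_pos hl0 _
  have hδ1 : δ ≤ 1 := Real.rpow_le_one_of_one_le_of_nonpos hl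
    (neg_nonpos.2 (by positivity))
  have hδN : δ ^ N = l⁻¹ := by
    rw [hδd, Real.rpow_neg hl0.le, inv_pow, one_div, Real.rpow_inv_natCast_pow hl0.le (by omega)]
  have hμ : |σ * l| * δ ^ N = 1 := by
    rw [abs_mul, hσ, one_mul, abs_of_pos hl0, hδN, mul_inv_cancel₀ hl0.ne']
  set K := M' + D * M with hK
  have hDM : 0 ≤ D * M := mul_nonneg hD hM
  have hxs : ∀ x ∈ Ioc (0 : ℝ) 1, x ≤ x ^ s := fun x hx => by
    simpa using Real.rpow_le_rpow_of_exponent_ge hx.1 hx.2 hs1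
  -- The tail of the model integral carries no factor `D`, so its coefficient `ψ 0` must be charged
  -- to `M'`; this is where `ψ 1 = 0` enters.
  have hψ0 : ‖ψ 0‖ ≤ M' := by
    have := norm_sub_le_of_deriv_bound dψ hψ' h11 h00
    simpa [hψ1] using this
  have hψc : Continuous ψ := continuous_iff_continuousAt.2 fun x => (dψ x).continuousAt
  -- Subtracting `ψ 0` times the Jacobian leaves an amplitude that vanishes to order `s` at 0.
  have main := H.norm_integral_le hN hs hs1 hδ hδ1 hμ (h := fun x => ψ x - ψ 0 * jac N f x)
    (h' := fun x => ψ' x - ψ 0 * jac' N f x) (A := C * K) (by positivity)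
    (hψc.continuousOn.sub (continuousOn_const.mul
      (Complex.continuous_ofReal.comp_continuousOn (H.continuousOn_jac hN))))
    (hψ'c.continuousOn.sub (continuousOn_const.mul
      (Complex.continuous_ofReal.comp_continuousOn (H.continuousOn_jac' hN))))
    (fun x hx => (dψ x).sub ((H.hasDerivAt_jac hN hx).ofReal_comp.const_mul _))
    (fun x hx => by
      have hx' := Ioc_subset_Icc_self hx
      have e1 : ψ x - ψ 0 * jac N f x = (ψ x - ψ 0) - ψ 0 * ((jac N f x - 1 : ℝ) : ℂ) := by
        push_cast; ring
      have e2 := norm_sub_le_of_deriv_bound dψ hψ' h00 hx'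
      rw [sub_zero, abs_of_pos hx.1] at e2
      have e3 := (hC f D s H hs x hx).1
      have hxs0 : 0 ≤ x ^ s := Real.rpow_nonneg hx.1.le _
      rw [e1]
      calc _ ≤ ‖ψ x - ψ 0‖ + ‖ψ 0‖ * |jac N f x - 1| := by
            refine (norm_sub_le _ _).trans ?_
            rw [norm_mul, Complex.norm_real, Real.norm_eq_abs]
        _ ≤ M' * x ^ s + M * (C * (D * x ^ s)) := by
            refine add_le_add (e2.trans (mul_le_mul_of_nonneg_left (hxs x hx) hM')) ?_
            exact mul_le_mul (hψ 0 h00) e3 (abs_nonneg _) hM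
        _ = (M' + C * (D * M)) * x ^ s := by ring
        _ ≤ C * K * x ^ s := by
            refine mul_le_mul_of_nonneg_right ?_ hxs0
            rw [hK]; nlinarith)
    (fun x hx => by
      have hx' := Ioc_subset_Icc_self hx
      have e3 := (hC f D s H hs x hx).2
      have hxs0 : 0 ≤ x ^ s / x := div_nonneg (Real.rpow_nonneg hx.1.le _) hx.1.le
      have hxs1 : 1 ≤ x ^ s / x := (one_le_div hx.1).2 (hxs x hx)
      calc _ ≤ ‖ψ' x‖ + ‖ψ 0‖ * |jac' N f x| := by
            refine (norm_sub_le _ _).trans ?_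
            rw [norm_mul, Complex.norm_real, Real.norm_eq_abs]
        _ ≤ M' * (x ^ s / x) + M * (C * (D * x ^ s / x)) := by
            refine add_le_add ((hψ' x hx').trans (le_mul_of_one_le_right hM' hxs1)) ?_
            exact mul_le_mul (hψ 0 h00) e3 (abs_nonneg _) hM
        _ = (M' + C * (D * M)) * (x ^ s / x) := by ring
        _ ≤ C * K * (x ^ s / x) := by
            refine mul_le_mul_of_nonneg_right ?_ hxs0
            rw [hK]; nlinarith)
  obtain ⟨hji, hjac⟩ := H.integral_exp_mul_jac hN (B := 1 + C * D) (fun x hx => by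
    have e3 := (hC f D s H hs x hx).1
    have : x ^ s ≤ 1 := Real.rpow_le_one hx.1.le hx.2 hs
    have e4 : C * (D * x ^ s) ≤ C * D := by
      have := mul_le_of_le_one_right hD this
      gcongr
    rw [abs_le] at e3 ⊢
    constructor <;> linarith [e3.1, e3.2]) (σ * l)
  set e : ℝ → ℂ := fun x => Complex.exp (Complex.I * (σ * l * f 0 x : ℝ)) with he
  have hei : IntervalIntegrable (fun x => e x * ψ x) volume 0 1 := by
    refine ContinuousOn.intervalIntegrable_of_Icc zero_le_one (ContinuousOn.mul ?_ hψc.continuousOn)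
    apply Complex.continuous_exp.comp_continuousOn
    exact continuousOn_const.mul (Complex.continuous_ofReal.comp_continuousOn
      (continuousOn_const.mul (H.continuousOn (by omega : 0 < N))))
  have split : ∫ x in (0 : ℝ)..1, e x * ψ x =
      (∫ x in (0 : ℝ)..1, e x * (ψ x - ψ 0 * jac N f x)) +
        ψ 0 * ∫ x in (0 : ℝ)..1, e x * jac N f x := by
    rw [← intervalIntegral.integral_const_mul, ← sub_eq_iff_eq_add,
      ← intervalIntegral.integral_sub hei (hji.const_mul _)]
    congr 1; ext x; ring
  set c := (l * lead N f) ^ (1 / (N : ℝ)) with hc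
  have hla : 0 < l * lead N f := mul_pos hl0 ha
  have hc0 : 0 < c := Real.rpow_pos_of_pos hla _
  have hcN : c ^ N = l * lead N f := by
    rw [hc, one_div, Real.rpow_inv_natCast_pow hla.le (by omega)]
  obtain ⟨u, hu, -, hfu⟩ := H.exists_ratio hs (Nat.zero_add N) (x := 1) ⟨zero_lt_one, le_rfl⟩
  have hu0 : 0 < u := by linarith [hu.1]
  have hfu' : f 0 1 / lead N f = u := by
    rw [hfu, div_eq_iff ha.ne', one_pow]; unfold lead; ring
  rw [hfu'] at hjac
  set S := u ^ (1 / (N : ℝ)) with hS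
  have hS0 : 0 < S := Real.rpow_pos_of_pos hu0 _
  have hSN : S ^ N = u := by
    rw [hS, one_div, Real.rpow_inv_natCast_pow hu0.le (by omega)]
  have hS100 : S ≤ 100 := rpow_one_div_le hN hu0.le hu.2 (by norm_num)
  have tail := norm_integral_exp_mul_pow_sub_le hN hσ hL hS0 hc0
  rw [hcN] at tail
  simp only [← mul_assoc] at tail
  -- `1 / S^(N-1) = S / u`, with `S ≤ 100` and `u ≥ 1/100`.
  have hSinv : 1 / S ^ (N - 1) ≤ 10000 := by
    rw [div_le_iff₀ (by positivity)]
    have : S ^ N = S ^ (N - 1) * S := by rw [← pow_succ]; congr 1; omega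
    have h3 : 0 < S ^ (N - 1) := by positivity
    have h4 := hu.1
    rw [← hSN, this] at h4
    nlinarith
  -- The tail has order `1 / l = δ^N`, which is small enough because `1 + s ≤ 2 ≤ N`.
  have hδs : δ ^ N ≤ δ * δ ^ s := by
    have h1 : δ ^ (2 : ℕ) ≤ δ * δ ^ s := by
      rw [pow_two]; gcongr; exact hxs δ ⟨hδ, hδ1⟩
    exact (pow_le_pow_of_le_one hδ.le hδ1 (by omega)).trans h1
  have tail' : 2 / (l * lead N f * S ^ (N - 1)) ≤ 200000 * F * (δ * δ ^ s) := by
    have h1 : 1 / lead N f ≤ 10 * F := by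
      rw [div_le_iff₀ ha]; exact H.one_le_mul_lead
    calc 2 / (l * lead N f * S ^ (N - 1)) = 2 * (l⁻¹ * ((1 / lead N f) * (1 / S ^ (N - 1)))) := by
          field_simp
      _ ≤ 2 * (δ ^ N * ((10 * F) * 10000)) := by rw [hδN]; gcongr
      _ ≤ 2 * ((δ * δ ^ s) * ((10 * F) * 10000)) := by gcongr
      _ = _ := by ring
  have final : (∫ x in (0 : ℝ)..1, e x * ψ x) - ψ 0 * ((c⁻¹ : ℝ) * L) =
      (∫ x in (0 : ℝ)..1, e x * (ψ x - ψ 0 * jac N f x)) +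
        ψ 0 * ((∫ x in (0 : ℝ)..1, e x * jac N f x) - (c⁻¹ : ℝ) * L) := by
    rw [split]; ring
  rw [final, hjac]
  calc _ ≤ C * K * (1 + 30 * F + 1000 * F ^ 2) * (δ * δ ^ s) + M' * (200000 * F * (δ * δ ^ s)) := by
        refine (norm_add_le _ _).trans (add_le_add main ?_)
        rw [norm_mul]
        exact mul_le_mul hψ0 (tail.trans tail') (norm_nonneg _) hM'
    _ ≤ C * K * (1 + 30 * F + 1000 * F ^ 2) * (δ * δ ^ s) + K * (200000 * F * (δ * δ ^ s)) := by
        gcongr; linarith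
    _ = _ := by ring

/-- Half-line asymptotics for all positive parameters. -/
theorem exists_half_bound {N : ℕ} (hN : 3 ≤ N) : ∃ C : ℝ, 0 ≤ C ∧
    ∀ (f : ℕ → ℝ → ℝ) (D s σ l M M' : ℝ) (ψ ψ' : ℝ → ℂ) (L : ℂ),
      HalfPhase N f D s → 0 ≤ s → s ≤ 1 → |σ| = 1 → 0 < l →
      Tendsto (fun T : ℝ => ∫ x in (0 : ℝ)..T,
        Complex.exp (Complex.I * (σ * x ^ N : ℝ))) atTop (𝓝 L) →
      (∀ x, HasDerivAt ψ (ψ' x) x) → Continuous ψ' →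
      (∀ x ∈ Icc (0 : ℝ) 1, ‖ψ x‖ ≤ M) → (∀ x ∈ Icc (0 : ℝ) 1, ‖ψ' x‖ ≤ M') → ψ 1 = 0 →
      ‖(∫ x in (0 : ℝ)..1, Complex.exp (Complex.I * (σ * l * f 0 x : ℝ)) * ψ x) -
          ψ 0 * ((((l * lead N f) ^ (1 / (N : ℝ)))⁻¹ : ℝ) * L)‖ ≤
        C * (1 + ‖L‖) * (l ^ (-(1 / (N : ℝ))) * (l ^ (-(1 / (N : ℝ)))) ^ s) * (M' + D * M) := by
  obtain ⟨C, hC0, hC⟩ := exists_half_bound_of_one_le hN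
  set F : ℝ := (N.factorial : ℝ) with hF
  have hF1 : 1 ≤ F := by
    rw [hF]; exact_mod_cast Nat.one_le_iff_ne_zero.2 (Nat.factorial_ne_zero _)
  refine ⟨C + 10 * F, by positivity, ?_⟩
  intro f D s σ l M M' ψ ψ' L H hs hs1 hσ hl0 hL dψ hψ'c hψ hψ' hψ1
  have ha := H.lead_pos
  have hD := H.nonneg
  have h00 : (0 : ℝ) ∈ Icc (0 : ℝ) 1 := ⟨le_rfl, zero_le_one⟩
  have h11 : (1 : ℝ) ∈ Icc (0 : ℝ) 1 := ⟨zero_le_one, le_rfl⟩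
  have hM : 0 ≤ M := (norm_nonneg _).trans (hψ 0 h00)
  have hM' : 0 ≤ M' := (norm_nonneg _).trans (hψ' 0 h00)
  have hDM : 0 ≤ D * M := mul_nonneg hD hM
  set δ := l ^ (-(1 / (N : ℝ))) with hδd
  have hδ : 0 < δ := Real.rpow_pos_of_pos hl0 _
  have hδs : 0 < δ ^ s := Real.rpow_pos_of_pos hδ _
  rcases le_total 1 l with hl | hl
  · refine (hC f D s σ l M M' ψ ψ' L H hs hs1 hσ hl hL dψ hψ'c hψ hψ' hψ1).trans ?_
    gcongr
    nlinarith [norm_nonneg L]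
  -- For `l ≤ 1` one has `δ ≥ 1`, so the integral and the leading term are bounded separately by
  -- their sizes.
  have hψM : ∀ x ∈ Icc (0 : ℝ) 1, ‖ψ x‖ ≤ M' := fun x hx => by
    have := norm_sub_le_of_deriv_bound dψ hψ' h11 hx
    rw [hψ1, sub_zero] at this
    refine this.trans (mul_le_of_le_one_right hM' ?_)
    rw [abs_le]; constructor <;> linarith [hx.1, hx.2]
  have hδ1 : 1 ≤ δ := Real.one_le_rpow_of_pos_of_le_one_of_nonpos hl0 hl
    (neg_nonpos.2 (by positivity))
  have hδs1 : 1 ≤ δ ^ s := Real.one_le_rpow hδ1 hs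
  have i1 : ‖∫ x in (0 : ℝ)..1, Complex.exp (Complex.I * (σ * l * f 0 x : ℝ)) * ψ x‖ ≤ M' := by
    have := intervalIntegral.norm_integral_le_of_norm_le_const (a := 0) (b := 1) (C := M')
      (f := fun x => Complex.exp (Complex.I * (σ * l * f 0 x : ℝ)) * ψ x) fun x hx => by
        rw [uIoc_of_le zero_le_one] at hx
        rw [norm_mul, norm_exp_I_mul, one_mul]
        exact hψM x (Ioc_subset_Icc_self hx)
    simpa using this
  have i2 : ((l * lead N f) ^ (1 / (N : ℝ)))⁻¹ ≤ δ * (10 * F) := by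
    rw [Real.mul_rpow hl0.le ha.le, mul_inv, ← Real.rpow_neg hl0.le, ← hδd,
      ← Real.inv_rpow ha.le]
    gcongr
    refine rpow_one_div_le hN (inv_nonneg.2 ha.le) ?_ (by linarith)
    rw [inv_le_iff_one_le_mul₀ ha]
    exact H.one_le_mul_lead
  have i3 : 0 ≤ ((l * lead N f) ^ (1 / (N : ℝ)))⁻¹ := by positivity
  calc _ ≤ M' + M' * (δ * (10 * F) * ‖L‖) := by
        refine (norm_sub_le _ _).trans (add_le_add i1 ?_)
        rw [norm_mul, norm_mul, Complex.norm_real, Real.norm_of_nonneg i3]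
        exact mul_le_mul (hψM 0 h00) (by gcongr) (by positivity) hM'
    _ ≤ M' * (10 * F * (δ * δ ^ s)) + M' * (10 * F * (δ * δ ^ s) * ‖L‖) := by
        have j1 : 1 ≤ δ * δ ^ s := one_le_mul_of_one_le_of_one_le hδ1 hδs1
        have j2 : δ ≤ δ * δ ^ s := le_mul_of_one_le_right hδ.le hδs1
        refine add_le_add (le_mul_of_one_le_right hM' ?_) ?_
        · nlinarith
        · refine mul_le_mul_of_nonneg_left (mul_le_mul_of_nonneg_right ?_ (norm_nonneg _)) hM'
          nlinarith
    _ = 10 * F * (1 + ‖L‖) * (δ * δ ^ s) * M' := by ring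
    _ ≤ _ := by
        gcongr <;> linarith

/-! ### Convergence of the Airy integral. -/

theorem integral_split_reflect {g : ℝ → ℂ} {a b : ℝ} (h1 : IntervalIntegrable g volume a 0)
    (h2 : IntervalIntegrable g volume 0 b) :
    ∫ x in a..b, g x = (∫ x in (0 : ℝ)..(-a), g (-x)) + ∫ x in (0 : ℝ)..b, g x := by
  rw [← intervalIntegral.integral_add_adjacent_intervals h1 h2,
    intervalIntegral.integral_comp_neg]
  simp

/-- The two-sided improper integral from the two half-line ones. -/
theorem tendsto_invFourierTrunc {k : ℕ} {ξ : ℝ} {Lp Lm : ℂ}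
    (hp : Tendsto (fun T : ℝ => ∫ x in (0 : ℝ)..T,
      Complex.exp (Complex.I * (1 * (x ^ (k + 1) + ξ * x) : ℝ))) atTop (𝓝 Lp))
    (hm : Tendsto (fun T : ℝ => ∫ x in (0 : ℝ)..T,
      Complex.exp (Complex.I * ((-1) ^ (k + 1) * (x ^ (k + 1) + -((-1) ^ (k + 1) * ξ) * x) : ℝ)))
      atTop (𝓝 Lm)) :
    Tendsto (invFourierTrunc (expPow k) ξ) (atBot ×ˢ atTop)
      (𝓝 (((Real.sqrt (2 * Real.pi))⁻¹ : ℝ) * (Lm + Lp))) := by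
  have h1 : Tendsto (fun ab : ℝ × ℝ => -ab.1) (atBot ×ˢ atTop) atTop :=
    tendsto_neg_atBot_atTop.comp tendsto_fst
  have h2 : Tendsto (fun ab : ℝ × ℝ => ab.2) (atBot ×ˢ atTop) atTop := tendsto_snd
  refine (((hm.comp h1).add (hp.comp h2)).const_mul _).congr fun ab => ?_
  unfold invFourierTrunc expPow
  congr 1
  have hc : Continuous fun x : ℝ => Complex.exp (Complex.I * (x * ξ : ℝ)) *
      Complex.exp (Complex.I * (x ^ (k + 1) : ℝ)) := by fun_prop
  rw [integral_split_reflect (hc.intervalIntegrable _ _) (hc.intervalIntegrable _ _)]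
  simp only [Function.comp_apply]
  congr 2
  -- Factoring the sign `(-1)^(k+1)` out of the reflected phase multiplies the linear coefficient by
  -- the same sign, its own inverse.
  · ext x
    rw [← Complex.exp_add, ← mul_add, ← Complex.ofReal_add, neg_pow x]
    congr 3
    have : ((-1 : ℝ) ^ (k + 1)) * (-1) ^ (k + 1) = 1 := by rw [← mul_pow]; simp
    linear_combination (-ξ * x) * this
  · ext x
    rw [← Complex.exp_add, ← mul_add, ← Complex.ofReal_add]
    congr 3
    ring

theorem exists_tendsto_invFourierTrunc {k : ℕ} (hk : 2 ≤ k) (ξ : ℝ) :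
    ∃ L, Tendsto (invFourierTrunc (expPow k) ξ) (atBot ×ˢ atTop) (𝓝 L) := by
  obtain ⟨Lp, hp⟩ := exists_tendsto_integral_exp_pow (N := k + 1) (by omega) one_ne_zero ξ
  obtain ⟨Lm, hm⟩ := exists_tendsto_integral_exp_pow (N := k + 1) (μ := (-1) ^ (k + 1)) (by omega)
    (by simp) (-((-1) ^ (k + 1) * ξ))
  exact ⟨_, tendsto_invFourierTrunc hp hm⟩

theorem tendsto_invFourierTrunc_Ai {k : ℕ} (hk : 2 ≤ k) (ξ : ℝ) :
    Tendsto (invFourierTrunc (expPow k) ξ) (atBot ×ˢ atTop) (𝓝 (Ai k ξ)) :=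
  tendsto_nhds_limUnder (exists_tendsto_invFourierTrunc hk ξ)

/-- `Ai_k(0)` as a sum of two half-line integrals. -/
theorem exists_half_airy {k : ℕ} (hk : 2 ≤ k) : ∃ Lp Lm : ℂ,
    Tendsto (fun T : ℝ => ∫ x in (0 : ℝ)..T,
      Complex.exp (Complex.I * (1 * x ^ (k + 1) : ℝ))) atTop (𝓝 Lp) ∧
    Tendsto (fun T : ℝ => ∫ x in (0 : ℝ)..T,
      Complex.exp (Complex.I * ((-1) ^ (k + 1) * x ^ (k + 1) : ℝ))) atTop (𝓝 Lm) ∧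
    (Real.sqrt (2 * Real.pi) : ℂ) * Ai k 0 = Lm + Lp := by
  obtain ⟨Lp, hp⟩ := exists_tendsto_integral_exp_pow (N := k + 1) (by omega) one_ne_zero 0
  obtain ⟨Lm, hm⟩ := exists_tendsto_integral_exp_pow (N := k + 1) (μ := (-1) ^ (k + 1)) (by omega)
    (by simp) 0
  refine ⟨Lp, Lm, by simpa using hp, by simpa using hm, ?_⟩
  rw [tendsto_nhds_unique (tendsto_invFourierTrunc_Ai hk 0)
    (tendsto_invFourierTrunc hp (by simpa using hm)), ← mul_assoc, ← Complex.ofReal_mul,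
    mul_inv_cancel₀ (by positivity), Complex.ofReal_one, one_mul]

/-! ### From the phase on [-1, 1] to two half phases. -/

theorem uniqueDiffOn_B1 : UniqueDiffOn ℝ B1 := uniqueDiffOn_Icc (by norm_num)

theorem IsPhase.hasDerivWithinAt {k : ℕ} {φ : ℝ → ℝ} (h : IsPhase k φ) {j : ℕ} (hj : j < k + 1)
    {x : ℝ} (hx : x ∈ B1) : HasDerivWithinAt (dB1 j φ) (dB1 (j + 1) φ x) B1 x := by
  have h1 := (h.contDiffOn.differentiableOn_iteratedDerivWithin (m := j) (by exact_mod_cast hj)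
    uniqueDiffOn_B1) x hx
  have h2 := h1.hasDerivWithinAt
  rw [← iteratedDerivWithin_succ] at h2
  exact h2

/-- Hölder continuity of the top derivative from the `L^p` bound on the next one. -/
theorem IsPhase.holder {k : ℕ} {φ : ℝ → ℝ} (h : IsPhase k φ) {p : ℝ} (hp : 1 < p)
    (hD : eLpNorm (dB1 (k + 2) φ) (ENNReal.ofReal p) (volume.restrict B1) ≠ ⊤) {x : ℝ}
    (hx : x ∈ B1) : |dB1 (k + 1) φ x - dB1 (k + 1) φ 0| ≤
      (eLpNorm (dB1 (k + 2) φ) (ENNReal.ofReal p) (volume.restrict B1)).toReal *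
        |x| ^ (1 - 1 / p) := by
  set g := dB1 (k + 1) φ with hg
  set G := dB1 (k + 2) φ with hG
  have h0 : (0 : ℝ) ∈ Icc (-1 : ℝ) 1 := by constructor <;> norm_num
  have hsub : uIcc 0 x ⊆ uIcc (-1 : ℝ) 1 := by
    rw [uIcc_of_le (by norm_num : (-1 : ℝ) ≤ 1)]
    exact uIcc_subset_Icc h0 hx
  have hac : AbsolutelyContinuousOnInterval g 0 x := h.absCont.mono hsub
  have hsub' : uIoc 0 x ⊆ B1 := by
    refine uIoc_subset_uIcc.trans ?_
    exact uIcc_subset_Icc h0 hx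
  -- At ±1 the derivatives in `dB1` are one-sided; these two points are discarded as a null set.
  have hae : deriv g =ᵐ[volume.restrict (uIoc 0 x)] G := by
    rw [EventuallyEq, ae_restrict_iff' measurableSet_uIoc]
    have e1 : ∀ᵐ y : ℝ, y ≠ -1 := by simp [ae_iff]
    have e2 : ∀ᵐ y : ℝ, y ≠ 1 := by simp [ae_iff]
    filter_upwards [e1, e2] with y hy1 hy2 hy
    have hy3 := hsub' hy
    have hn : B1 ∈ 𝓝 y :=
      Icc_mem_nhds (lt_of_le_of_ne hy3.1 (Ne.symm hy1)) (lt_of_le_of_ne hy3.2 hy2)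
    rw [hG, dB1, iteratedDerivWithin_succ, derivWithin_of_mem_nhds hn, hg]
    rfl
  have hp1 : (1 : ℝ≥0∞) ≤ ENNReal.ofReal p := by
    rw [← ENNReal.ofReal_one]; exact ENNReal.ofReal_le_ofReal hp.le
  have hvol : (volume.restrict (uIoc 0 x)) univ = ENNReal.ofReal |x| := by
    rw [Measure.restrict_apply_univ, Real.volume_uIoc, sub_zero]
  have key : ENNReal.ofReal |g x - g 0| ≤
      eLpNorm G (ENNReal.ofReal p) (volume.restrict B1) * ENNReal.ofReal |x| ^ (1 - 1 / p) := by
    rw [← hac.integral_deriv_eq_sub, ← Real.norm_eq_abs,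
      intervalIntegral.norm_intervalIntegral_eq, ofReal_norm]
    -- Hölder's inequality on an interval of length `|x|` gives the exponent `1 - 1 / p`.
    calc _ ≤ ∫⁻ y in uIoc 0 x, ‖deriv g y‖ₑ := enorm_integral_le_lintegral_enorm _
      _ = eLpNorm (deriv g) 1 (volume.restrict (uIoc 0 x)) := eLpNorm_one_eq_lintegral_enorm.symm
      _ ≤ eLpNorm (deriv g) (ENNReal.ofReal p) (volume.restrict (uIoc 0 x)) *
          (volume.restrict (uIoc 0 x)) univ ^
            (1 / (1 : ℝ≥0∞).toReal - 1 / (ENNReal.ofReal p).toReal) :=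
        eLpNorm_le_eLpNorm_mul_rpow_measure_univ hp1 (measurable_deriv g).aestronglyMeasurable
      _ = eLpNorm G (ENNReal.ofReal p) (volume.restrict (uIoc 0 x)) *
          ENNReal.ofReal |x| ^ (1 - 1 / p) := by
        rw [eLpNorm_congr_ae hae, hvol, ENNReal.toReal_ofReal (by linarith)]
        simp
      _ ≤ _ := by
        gcongr
  have hs : 0 ≤ 1 - 1 / p := by
    have : 1 / p ≤ 1 := (div_le_one (by linarith)).2 hp.le
    linarith
  rw [ENNReal.ofReal_rpow_of_nonneg (abs_nonneg x) hs, ← ENNReal.ofReal_toReal hD,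
    ← ENNReal.ofReal_mul ENNReal.toReal_nonneg] at key
  exact (ENNReal.ofReal_le_ofReal_iff (by positivity)).1 key

theorem Icc_zero_one_subset_B1 : Icc (0 : ℝ) 1 ⊆ B1 := Icc_subset_Icc_left (by norm_num)

theorem neg_mem_B1 {x : ℝ} (hx : x ∈ B1) : -x ∈ B1 := ⟨by linarith [hx.2], by linarith [hx.1]⟩

theorem IsPhase.halfPhase {k : ℕ} {φ : ℝ → ℝ} (h : IsPhase k φ) {D s : ℝ}
    (hD : ∀ x ∈ B1, |dB1 (k + 1) φ x - dB1 (k + 1) φ 0| ≤ D * |x| ^ s) :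
    HalfPhase (k + 1) (fun j => dB1 j φ) D s where
  hasDeriv j hj x hx :=
    (h.hasDerivWithinAt hj (Icc_zero_one_subset_B1 hx)).mono Icc_zero_one_subset_B1
  zero j hj := h.vanish j (by omega)
  bounds x hx := h.bounds x (Icc_zero_one_subset_B1 hx)
  holder x hx := by simpa [abs_of_nonneg hx.1] using hD x (Icc_zero_one_subset_B1 hx)

/-- Reflection multiplies the j-th derivative by `(-1)^j`. The further factor `(-1)^(k+1)` makes the
top derivative positive again, and is compensated by taking that sign for `σ`. -/
theorem IsPhase.halfPhase_neg {k : ℕ} {φ : ℝ → ℝ} (h : IsPhase k φ) {D s : ℝ}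
    (hD : ∀ x ∈ B1, |dB1 (k + 1) φ x - dB1 (k + 1) φ 0| ≤ D * |x| ^ s) :
    HalfPhase (k + 1) (fun j x => (-1) ^ (k + 1 + j) * dB1 j φ (-x)) D s where
  hasDeriv j hj x hx := by
    have h1 := h.hasDerivWithinAt hj (neg_mem_B1 (Icc_zero_one_subset_B1 hx))
    have h2 := (h1.scomp x (hasDerivAt_neg x).hasDerivWithinAt
      (fun y hy => neg_mem_B1 (Icc_zero_one_subset_B1 hy))).const_mul ((-1 : ℝ) ^ (k + 1 + j))
    refine h2.congr_deriv ?_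
    rw [smul_eq_mul, ← add_assoc, pow_succ]
    ring
  zero j hj := by simp [h.vanish j (by omega)]
  bounds x hx := by
    have := h.bounds (-x) (neg_mem_B1 (Icc_zero_one_subset_B1 hx))
    simpa [← two_mul] using this
  holder x hx := by
    have := hD (-x) (neg_mem_B1 (Icc_zero_one_subset_B1 hx))
    simpa [← two_mul, abs_of_nonneg hx.1] using this

/-! ### Supremum norms, the splitting of the integral, and the leading term. -/

/-- The set where a continuous function exceeds its essential supremum is open and null, hence
empty. -/
theorem enorm_le_eLpNorm_top {g : ℝ → ℂ} (hg : Continuous g) (h0 : ∀ x, x ∉ B1 → g x = 0)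
    (x : ℝ) : ‖g x‖ₑ ≤ eLpNorm g ∞ (volume.restrict B1) := by
  set c := eLpNorm g ∞ (volume.restrict B1) with hc
  have hae : ∀ᵐ y : ℝ, ‖g y‖ₑ ≤ c := by
    have h1 : ∀ᵐ y ∂(volume.restrict B1), ‖g y‖ₑ ≤ c := by
      rw [hc, eLpNorm_exponent_top]
      exact ae_le_eLpNormEssSup
    have hB : MeasurableSet B1 := measurableSet_Icc
    rw [ae_restrict_iff' hB] at h1
    filter_upwards [h1] with y hy
    by_cases hyB : y ∈ B1
    · exact hy hyB
    · simp [h0 y hyB]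
  have hopen : IsOpen {y : ℝ | c < ‖g y‖ₑ} := isOpen_lt continuous_const hg.enorm
  have hnull : volume {y : ℝ | c < ‖g y‖ₑ} = 0 := by
    have := ae_iff.1 hae
    simpa only [not_le] using this
  have hempty := (hopen.measure_eq_zero_iff volume).1 hnull
  by_contra hx
  have : x ∈ {y : ℝ | c < ‖g y‖ₑ} := not_le.1 hx
  rw [hempty] at this
  exact this

theorem integral_eq_intervalIntegral_of_B1 {g : ℝ → ℂ} (h0 : ∀ x, x ∉ B1 → g x = 0) :
    ∫ x, g x = ∫ x in (-1 : ℝ)..1, g x := by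
  rw [intervalIntegral.integral_of_le (by norm_num), ← integral_Icc_eq_integral_Ioc]
  exact (setIntegral_eq_integral_of_forall_compl_eq_zero fun x hx => h0 x hx).symm

theorem oscI_eq {φ : ℝ → ℝ} {ψ : ℝ → ℂ} (hφ : ContinuousOn φ B1) (hψ : Continuous ψ)
    (h0 : ∀ x, x ∉ B1 → ψ x = 0) (k : ℕ) (l : ℝ) :
    oscI φ ψ l =
      (∫ x in (0 : ℝ)..1, Complex.exp (Complex.I *
        ((-1) ^ (k + 1) * l * ((-1) ^ (k + 1 + 0) * dB1 0 φ (-x)) : ℝ)) * ψ (-x)) +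
      ∫ x in (0 : ℝ)..1, Complex.exp (Complex.I * (1 * l * dB1 0 φ x : ℝ)) * ψ x := by
  have hc : ContinuousOn (fun x : ℝ => Complex.exp (Complex.I * (l * φ x : ℝ)) * ψ x) B1 := by
    refine ContinuousOn.mul ?_ hψ.continuousOn
    apply Complex.continuous_exp.comp_continuousOn
    exact continuousOn_const.mul
      (Complex.continuous_ofReal.comp_continuousOn (continuousOn_const.mul hφ))
  have hi : IntervalIntegrable (fun x : ℝ => Complex.exp (Complex.I * (l * φ x : ℝ)) * ψ x)
      volume (-1) 1 := ContinuousOn.intervalIntegrable_of_Icc (by norm_num) hc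
  unfold oscI
  rw [integral_eq_intervalIntegral_of_B1 fun x hx => by rw [h0 x hx, mul_zero],
    integral_split_reflect
      (hi.mono_set (by rw [uIcc_of_le, uIcc_of_le] <;> [apply Icc_subset_Icc; skip; skip] <;> norm_num))
      (hi.mono_set (by rw [uIcc_of_le, uIcc_of_le] <;> [apply Icc_subset_Icc; skip; skip] <;> norm_num)),
    neg_neg]
  have hsq : ((-1 : ℝ) ^ (k + 1)) * (-1) ^ (k + 1) = 1 := by rw [← mul_pow]; simp
  congr 2
  · ext x
    simp only [dB1, iteratedDerivWithin_zero, add_zero]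
    congr 4
    linear_combination (-l * φ (-x)) * hsq
  · ext x
    simp only [dB1, iteratedDerivWithin_zero, one_mul]

/-- The factorial in `c_k` turns `φ^(k+1)(0)` into the Taylor coefficient, and its `√(2π)` undoes
the Fourier normalization. -/
theorem leading_eq {k : ℕ} {φ : ℝ → ℝ} (h : IsPhase k φ) (ψ : ℝ → ℂ) {l : ℝ} (hl : 0 < l)
    {L : ℂ} (hL : (Real.sqrt (2 * Real.pi) : ℂ) * Ai k 0 = L) :
    leading k φ ψ l =
      ψ 0 * ((((l * (dB1 (k + 1) φ 0 / (k + 1).factorial)) ^ (1 / ((k + 1 : ℕ) : ℝ)))⁻¹ : ℝ) * L) := by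
  have hb : 0 < dB1 (k + 1) φ 0 := by
    have := (h.bounds 0 (by constructor <;> norm_num)).1
    linarith
  unfold leading cConst
  rw [← hL, Nat.cast_succ, Real.mul_rpow hl.le (by positivity), Real.div_rpow hb.le (by positivity),
    Real.rpow_neg hl.le]
  have h1 : 0 < l ^ (1 / ((k : ℝ) + 1)) := by positivity
  have h2 : 0 < dB1 (k + 1) φ 0 ^ (1 / ((k : ℝ) + 1)) := by positivity
  have h3 : 0 < ((k + 1).factorial : ℝ) ^ (1 / ((k : ℝ) + 1)) := by positivity
  have h1' := Complex.ofReal_ne_zero.2 h1.ne'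
  have h2' := Complex.ofReal_ne_zero.2 h2.ne'
  have h3' := Complex.ofReal_ne_zero.2 h3.ne'
  simp only [Complex.ofReal_mul, Complex.ofReal_inv, Complex.ofReal_div]
  field_simp

theorem norm_le_toReal_eLpNorm {g : ℝ → ℂ} (hg : Continuous g) (h0 : ∀ x, x ∉ B1 → g x = 0)
    (hfin : eLpNorm g ∞ (volume.restrict B1) ≠ ⊤) (x : ℝ) :
    ‖g x‖ ≤ (eLpNorm g ∞ (volume.restrict B1)).toReal := by
  rw [← toReal_enorm]
  exact ENNReal.toReal_mono hfin (enorm_le_eLpNorm_top hg h0 x)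

/-! ### Assembling the remainder bound. -/

/-- The remainder estimate in real form. -/
theorem exists_remainder_bound {k : ℕ} (hk : 2 ≤ k) : ∃ C : ℝ, 0 < C ∧
    ∀ (φ : ℝ → ℝ) (ψ : ℝ → ℂ) (l s D M M' : ℝ), IsPhase k φ → 0 ≤ s → s ≤ 1 → 0 < l →
      (∀ x ∈ B1, |dB1 (k + 1) φ x - dB1 (k + 1) φ 0| ≤ D * |x| ^ s) →
      ContDiff ℝ 1 ψ → tsupport ψ ⊆ B1 → (∀ x, ‖ψ x‖ ≤ M) → (∀ x, ‖deriv ψ x‖ ≤ M') →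
      ‖remainder k φ ψ l‖ ≤
        C * (l ^ (-(1 / ((k : ℝ) + 1))) * l ^ (-(s / ((k : ℝ) + 1)))) * (D * M + M') := by
  obtain ⟨C, hC0, hC⟩ := exists_half_bound (N := k + 1) (by omega)
  obtain ⟨Lp, Lm, hLp, hLm, hA⟩ := exists_half_airy hk
  -- The final `+ 1` makes the constant strictly positive, so that it times ∞ is ∞.
  refine ⟨C * (1 + ‖Lm‖) + C * (1 + ‖Lp‖) + 1, by positivity, ?_⟩
  intro φ ψ l s D M M' hφ hs hs1 hl hD hψ hsupp hM hM'
  have hψc := hψ.continuous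
  have hψ'c : Continuous (deriv ψ) := hψ.continuous_deriv le_rfl
  have dψ : ∀ x, HasDerivAt ψ (deriv ψ x) x := fun x =>
    (hψ.differentiable one_ne_zero x).hasDerivAt
  have h0 : ∀ x, x ∉ B1 → ψ x = 0 := fun x hx => by
    by_contra h; exact hx (hsupp (subset_tsupport _ h))
  -- The set where `ψ ≠ 0` is open and contained in [-1, 1], so it misses the end points.
  have hend : ∀ x, x ∉ Ioo (-1 : ℝ) 1 → ψ x = 0 := fun x hx => by
    by_contra h
    apply hx
    rw [← interior_Icc]
    exact interior_maximal ((subset_tsupport ψ).trans hsupp)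
      (isOpen_ne_fun hψc continuous_const) h
  have hp := hC _ D s 1 l M M' ψ (deriv ψ) Lp (hφ.halfPhase hD) hs hs1 (by simp) hl hLp dψ hψ'c
    (fun x _ => hM x) (fun x _ => hM' x) (hend 1 (by simp))
  have hm := hC _ D s ((-1) ^ (k + 1)) l M M' (fun x => ψ (-x)) (fun x => -deriv ψ (-x)) Lm
    (hφ.halfPhase_neg hD) hs hs1 (by simp) hl hLm
    (fun x => ((dψ (-x)).scomp x (hasDerivAt_neg x)).congr_deriv (by simp)) (by fun_prop)
    (fun x _ => hM _) (fun x _ => by simpa using hM' (-x)) (hend (-1) (by simp))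
  have hlead : lead (k + 1) (fun j x => (-1) ^ (k + 1 + j) * dB1 j φ (-x)) =
      dB1 (k + 1) φ 0 / (k + 1).factorial := by
    simp [lead, ← two_mul]
  have hlead' : lead (k + 1) (fun j => dB1 j φ) = dB1 (k + 1) φ 0 / (k + 1).factorial := rfl
  rw [hlead] at hm
  rw [hlead'] at hp
  simp only [neg_zero] at hm
  have hexp : (l ^ (-(1 / ((k + 1 : ℕ) : ℝ)))) ^ s = l ^ (-(s / ((k : ℝ) + 1))) := by
    rw [← Real.rpow_mul hl.le]
    congr 1
    push_cast
    ring
  rw [hexp, Nat.cast_succ] at hm hp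
  have hDM : 0 ≤ M' + D * M := by
    have h1 := (hφ.halfPhase hD).nonneg
    have h2 := (norm_nonneg _).trans (hM 0)
    have h3 := (norm_nonneg _).trans (hM' 0)
    positivity
  unfold remainder
  rw [oscI_eq hφ.contDiffOn.continuousOn hψc h0 k l, leading_eq hφ ψ hl hA, Nat.cast_succ]
  set E := l ^ (-(1 / ((k : ℝ) + 1))) * l ^ (-(s / ((k : ℝ) + 1))) with hE
  have hE0 : 0 ≤ E := by positivity
  rw [mul_add, mul_add, add_sub_add_comm]
  refine (norm_add_le _ _).trans ((add_le_add hm hp).trans ?_)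
  have := mul_nonneg hE0 hDM
  rw [add_comm (D * M)]
  nlinarith

end OscInt

/-- `Ai_k` is well defined (the improper integral converges at every point), and the remainder
satisfies the stated bound with a constant depending only on `k`. The inequality is written in
`[0, ∞]`; it is void when `φ^(k+2)` is not in `L^p` and `ψ` is not zero. Here `p' = p / (p - 1)`,
that is, `1 / p' = 1 - 1 / p`. -/
theorem theorem2 (k : ℕ) (hk : 2 ≤ k) :
    (∀ ξ : ℝ, Tendsto (OscInt.invFourierTrunc (OscInt.expPow k) ξ) (atBot ×ˢ atTop)
      (𝓝 (OscInt.Ai k ξ))) ∧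
    ∃ C : ℝ≥0, ∀ (φ : ℝ → ℝ) (ψ : ℝ → ℂ) (l p : ℝ),
      OscInt.IsPhase k φ → ContDiff ℝ ∞ ψ → tsupport ψ ⊆ OscInt.B1 →
      0 < l → 1 < p → p ≤ 2 →
      ‖OscInt.remainder k φ ψ l‖ₑ ≤
        C * ENNReal.ofReal (l ^ (-(1 / ((k : ℝ) + 1))) *
            l ^ (-((1 - 1 / p) / ((k : ℝ) + 1)))) *
          (eLpNorm (OscInt.dB1 (k + 2) φ) (ENNReal.ofReal p) (volume.restrict OscInt.B1) *
              eLpNorm ψ ∞ (volume.restrict OscInt.B1) +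
            eLpNorm (deriv ψ) ∞ (volume.restrict OscInt.B1)) := by
  refine ⟨OscInt.tendsto_invFourierTrunc_Ai hk, ?_⟩
  obtain ⟨C, hC0, hC⟩ := OscInt.exists_remainder_bound hk
  refine ⟨C.toNNReal, fun φ ψ l p hφ hψ hsupp hl hp _ => ?_⟩
  have hψc := hψ.continuous
  have hψ1 : ContDiff ℝ 1 ψ := hψ.of_le (by exact_mod_cast le_top)
  have hψ'c : Continuous (deriv ψ) := hψ1.continuous_deriv le_rfl
  have hcs : HasCompactSupport ψ := isCompact_Icc.of_isClosed_subset (isClosed_tsupport ψ) hsupp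
  have h0 : ∀ x, x ∉ OscInt.B1 → ψ x = 0 := fun x hx => by
    by_contra h; exact hx (hsupp (subset_tsupport _ h))
  have h0' : ∀ x, x ∉ OscInt.B1 → deriv ψ x = 0 := fun x hx => by
    by_contra h; exact hx (hsupp (support_deriv_subset h))
  have hM : eLpNorm ψ ∞ (volume.restrict OscInt.B1) ≠ ⊤ :=
    (hψc.memLp_top_of_hasCompactSupport hcs _).2.ne
  have hM' : eLpNorm (deriv ψ) ∞ (volume.restrict OscInt.B1) ≠ ⊤ :=
    (hψ'c.memLp_top_of_hasCompactSupport hcs.deriv _).2.ne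
  have hE : 0 < l ^ (-(1 / ((k : ℝ) + 1))) * l ^ (-((1 - 1 / p) / ((k : ℝ) + 1))) := by
    positivity
  -- If the L^p norm is infinite, so is the right-hand side, unless `ψ` is zero: then 0 · ∞ = 0 and
  -- the remainder vanishes too.
  rcases eq_or_ne (eLpNorm (OscInt.dB1 (k + 2) φ) (ENNReal.ofReal p)
    (volume.restrict OscInt.B1)) ⊤ with hD | hD
  · rcases eq_or_ne (eLpNorm ψ ∞ (volume.restrict OscInt.B1)) 0 with hz | hz
    · have hψ0 : ∀ x, ψ x = 0 := fun x => by
        have := OscInt.enorm_le_eLpNorm_top hψc h0 x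
        rw [hz] at this
        simpa using this
      have : OscInt.remainder k φ ψ l = 0 := by
        simp [OscInt.remainder, OscInt.oscI, OscInt.leading, hψ0]
      simp [this]
    · rw [hD, ENNReal.top_mul hz, top_add, ENNReal.mul_top]
      · exact le_top
      · refine mul_ne_zero ?_ ?_
        · simpa using hC0
        · simpa using hE
  · have hs0 : 0 ≤ 1 - 1 / p := by
      have : 1 / p ≤ 1 := (div_le_one (by linarith)).2 hp.le
      linarith
    have hs1 : 1 - 1 / p ≤ 1 := by
      have : 0 ≤ 1 / p := by positivity
      linarith
    have key := hC φ ψ l (1 - 1 / p) _ _ _ hφ hs0 hs1 hl (fun x hx => hφ.holder hp hD hx)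
      hψ1 hsupp (OscInt.norm_le_toReal_eLpNorm hψc h0 hM)
      (OscInt.norm_le_toReal_eLpNorm hψ'c h0' hM')
    rw [← ofReal_norm]
    refine (ENNReal.ofReal_le_ofReal key).trans (le_of_eq ?_)
    rw [ENNReal.ofReal_mul (by positivity), ENNReal.ofReal_mul hC0.le,
      ENNReal.ofReal_add (by positivity) ENNReal.toReal_nonneg,
      ENNReal.ofReal_mul ENNReal.toReal_nonneg, ENNReal.ofReal_toReal hD, ENNReal.ofReal_toReal hM,
      ENNReal.ofReal_toReal hM']
    rfl
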